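/- Let $k$ be $\mathbb{C}$ or $\mathbb{R}$ and let $n \ge 0$ be an integer. Let $$P_n(k)=\{(X,Z)\in \mathfrak{gl}_n(k)^{2} : \operatorname{rank}([X,Z]+I_n)=1\},$$ on which $GL_n(k)$ acts by simultaneous conjugation, and put $\overline{C}_n=P_n(\mathbb{C})$ and $\overline{R}_n=P_n(\mathbb{R})$. These are affine varieties whose coordinate rings consist of the restrictions of polynomials in the matrix entries $x_{jl}, z_{jl}$. Let $\pi_n:\overline{C}_n\to C_n=\overline{C}_n/GL_n(\mathbb{C})$ be the Calogero--Moser space, i.e. the space of orbits with coordinate ring $\mathcal{O}(C_n)=\mathcal{O}(\overline{C}_n)^{GL_n(\mathbb{C})}$. View $C_n$ also as a real variety, with the real functions generated by the real and imaginary parts of the elements of $\mathcal{O}(C_n)$. Let $\overline{i}_n:\overline{R}_n\hookrightarrow\overline{C}_n$ be the inclusion, let $RC_n=\pi_n(\overline{i}_n(\overline{R}_n))$ be the real locus of $C_n$, and let $$\mathcal{O}^{\mathbb{R}}(C_n)=\mathcal{O}(\overline{C}_n)^{GL_n(\mathbb{C})}\cap\mathbb{R}[x_{jl},z_{jl}]_{j,l=1}^n\subset\mathcal{O}(C_n)$$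 be the set of invariant functions on $\overline{C}_n$ that are given by polynomials with real coefficients. Then the following hold. 1. $RC_n=\{c\in C_n : f(c)\in\mathbb{R}\text{ for all } f\in\mathcal{O}^{\mathbb{R}}(C_n)\}$, and this is a real algebraic (real Zariski closed) subset of $C_n$. 2. The action of $GL_n(\mathbb{R})$ on $\overline{R}_n$ has a geometric quotient $\nu_n:\overline{R}_n\to R_n=\overline{R}_n/GL_n(\mathbb{R})$, which is a smooth real affine variety. That is, $\nu_n$ is a surjective morphism whose fibres are exactly the $GL_n(\mathbb{R})$-orbits; $R_n$ carries the quotient of the Zariski topology; for each open $U\subseteq R_n$ the regular functions on $U$ are the $GL_n(\mathbb{R})$-invariant regular functions on $\nu_n^{-1}(U)$; and the coordinate ring of $R_n$ is $\mathcal{O}(\overline{R}_n)^{GL_n(\mathbb{R})}$. 3. The inclusion $\overline{i}_n$ induces a morphism of real varieties $i_n:R_n\to C_n$ with $i_n\circ\nu_n=\pi_n\circ\overline{i}_n$. It takes values in $RC_n$ and is an isomorphism of real varieties $R_n\cong RC_n$, where $RC_n$ carries the structure induced from the real variety $C_n$. -/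

import Mathlib

open Matrix

noncomputable section

namespace RealCM

/-! ### Classical affine varieties

A classical affine variety over a field `k` is recorded as its set of points `X` together with its
coordinate ring, a `k`-subalgebra `A` of the algebra of all functions `X → k`. The Zariski
topology and the sheaf of regular functions are derived from `A`. -/

section Varieties

variable {k : Type*} [Field k] {X Y : Type*}

/-- Pullback of functions along a map of sets. -/
def pullback (k : Type*) [Field k] {X Y : Type*} (φ : X → Y) : (Y → k) →ₐ[k] (X → k) :=
  AlgHom.pi fun x => Pi.evalAlgHom k (fun _ : Y => k) (φ x)

/-- `(X, A)` is an affine algebraic variety: it is isomorphic to the zero set in some affine space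
`k ^ N` of a family of polynomials, with the restrictions of polynomials as coordinate ring. -/
def IsAffineVariety (A : Subalgebra k (X → k)) : Prop :=
  ∃ (N : ℕ) (φ : X → Fin N → k) (S : Set (MvPolynomial (Fin N) k)),
    Function.Injective φ ∧
    Set.range φ = {v | ∀ p ∈ S, MvPolynomial.eval v p = 0} ∧
    ∀ f : X → k, f ∈ A ↔ ∃ p : MvPolynomial (Fin N) k, ∀ x, f x = MvPolynomial.eval (φ x) p

/-- `Z` is an algebraic subset, i.e. the common zero set of some family in `A`. -/
def IsZariskiClosed (A : Subalgebra k (X → k)) (Z : Set X) : Prop :=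
  ∃ S : Set (X → k), S ⊆ A ∧ Z = {x | ∀ f ∈ S, f x = 0}

def IsZariskiOpen (A : Subalgebra k (X → k)) (U : Set X) : Prop :=
  IsZariskiClosed A Uᶜ

/-- `f` is a regular function on the open set `U`: near each point of `U` it is a fraction `p / q`
with `p, q ∈ A`. (The values of `f` outside `U` are irrelevant. The neighbourhood can be taken to
be `{y ∈ U | q y ≠ 0}`, since such sets form a basis of the topology of `U`.) -/
def IsRegularOn (A : Subalgebra k (X → k)) (U : Set X) (f : X → k) : Prop :=
  ∀ x ∈ U, ∃ p ∈ A, ∃ q ∈ A, q x ≠ 0 ∧ ∀ y ∈ U, q y ≠ 0 → f y = p y / q y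

/-- Morphisms of affine varieties: maps that pull coordinate functions back to coordinate
functions. -/
def IsMorphism (A : Subalgebra k (X → k)) (B : Subalgebra k (Y → k)) (φ : X → Y) : Prop :=
  ∀ b ∈ B, b ∘ φ ∈ A

/-- Isomorphisms of affine varieties: bijections under which the coordinate rings correspond. -/
def IsIsomorphism (A : Subalgebra k (X → k)) (B : Subalgebra k (Y → k)) (φ : X → Y) : Prop :=
  Function.Bijective φ ∧ ∀ b : Y → k, b ∈ B ↔ b ∘ φ ∈ A

/-- The structure induced on a subset `S`: restrictions of the functions in `A`. -/
def restrict (A : Subalgebra k (X → k)) (S : Set X) : Subalgebra k (S → k) :=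
  A.map (pullback k (Subtype.val : S → X))

/-- Evaluation of coordinate functions at a point. -/
def evalAt (A : Subalgebra k (X → k)) (x : X) : A →ₐ[k] k :=
  (Pi.evalAlgHom k (fun _ : X => k) x).comp A.val

/-- The maximal ideal of the coordinate ring of functions that vanish at `x`. -/
def idealAt (A : Subalgebra k (X → k)) (x : X) : Ideal A := RingHom.ker (evalAt A x)

instance idealAt_isPrime (A : Subalgebra k (X → k)) (x : X) : (idealAt A x).IsPrime :=
  RingHom.ker_isPrime (evalAt A x)

/-- `(X, A)` is smooth: for each point `x`, the local ring of `A` at `x` is smooth over `k`. -/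
def IsSmoothVariety (A : Subalgebra k (X → k)) : Prop :=
  ∀ x : X, Algebra.IsSmoothAt k (idealAt A x)

/-- `ν : (X, A) → (Y, B)` is a geometric quotient for the action of `G` on `X`. -/
structure IsGeometricQuotient (G : Type*) [Group G] [MulAction G X]
    (A : Subalgebra k (X → k)) (B : Subalgebra k (Y → k)) (ν : X → Y) : Prop where
  /-- `ν` is a morphism. -/
  morphism : IsMorphism A B ν
  surjective : Function.Surjective ν
  /-- The fibres of `ν` are exactly the orbits. -/
  fibres : ∀ x x' : X, ν x = ν x' ↔ ∃ g : G, g • x = x'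
  /-- `Y` carries the quotient topology. -/
  quotient_topology : ∀ U : Set Y, IsZariskiOpen B U ↔ IsZariskiOpen A (ν ⁻¹' U)
  /-- The regular functions on an open `U` are the invariant regular functions on `ν ⁻¹ U`. -/
  sheaf : ∀ U : Set Y, IsZariskiOpen B U → ∀ F : X → k,
    (IsRegularOn A (ν ⁻¹' U) F ∧ ∀ (g : G), ∀ x ∈ ν ⁻¹' U, F (g • x) = F x) ↔
      ∃ f : Y → k, IsRegularOn B U f ∧ ∀ x ∈ ν ⁻¹' U, F x = f (ν x)
  /-- The coordinate ring of `Y` is the ring of invariants in the coordinate ring of `X`. -/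
  coordinate_ring : ∀ F : X → k,
    (F ∈ A ∧ ∀ (g : G) (x : X), F (g • x) = F x) ↔ ∃ f ∈ B, F = f ∘ ν

/-- A complex affine variety viewed as a real variety: the same points, with the real algebra
generated by the real and imaginary parts of the complex coordinate functions. -/
def realStructure {X : Type*} (A : Subalgebra ℂ (X → ℂ)) : Subalgebra ℝ (X → ℝ) :=
  Algebra.adjoin ℝ
    ({g | ∃ f ∈ A, g = fun x => (f x).re} ∪ {g | ∃ f ∈ A, g = fun x => (f x).im})

end Varieties

/-! ### Calogero-Moser spaces -/

/-- Pairs `(X, Z)` of `n × n` matrices over `k` with `rank ([X, Z] + I) = 1`. -/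
def Pairs (k : Type*) [Field k] (n : ℕ) : Type _ :=
  {p : Matrix (Fin n) (Fin n) k × Matrix (Fin n) (Fin n) k //
    (p.1 * p.2 - p.2 * p.1 + 1).rank = 1}

/-- Conjugation `g M g⁻¹`. -/
def conj {k : Type*} [Field k] {n : ℕ} (g : GL (Fin n) k) (M : Matrix (Fin n) (Fin n) k) :
    Matrix (Fin n) (Fin n) k :=
  (g : Matrix (Fin n) (Fin n) k) * M * (↑g⁻¹ : Matrix (Fin n) (Fin n) k)

theorem rank_conj {k : Type*} [Field k] {n : ℕ} (g : GL (Fin n) k)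
    (M : Matrix (Fin n) (Fin n) k) : (conj g M).rank = M.rank := by
  rw [conj, rank_mul_eq_left_of_isUnit_det _ _ ((isUnit_iff_isUnit_det _).1 (Units.isUnit g⁻¹)),
    rank_mul_eq_right_of_isUnit_det _ _ ((isUnit_iff_isUnit_det _).1 (Units.isUnit g))]

theorem conj_mul {k : Type*} [Field k] {n : ℕ} (g : GL (Fin n) k)
    (A B : Matrix (Fin n) (Fin n) k) : conj g A * conj g B = conj g (A * B) := by
  have h : (↑g⁻¹ : Matrix (Fin n) (Fin n) k) * (g : Matrix (Fin n) (Fin n) k) = 1 :=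
    Units.inv_mul g
  calc _ = (g : Matrix (Fin n) (Fin n) k) * A *
        ((↑g⁻¹ : Matrix (Fin n) (Fin n) k) * (g : Matrix (Fin n) (Fin n) k)) * B *
          (↑g⁻¹ : Matrix (Fin n) (Fin n) k) := by
        simp only [conj, Matrix.mul_assoc]
    _ = _ := by rw [h]; simp only [conj, Matrix.mul_assoc, Matrix.one_mul]

theorem conj_comm {k : Type*} [Field k] {n : ℕ} (g : GL (Fin n) k)
    (A B : Matrix (Fin n) (Fin n) k) :
    conj g A * conj g B - conj g B * conj g A + 1 = conj g (A * B - B * A + 1) := by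
  have h : (g : Matrix (Fin n) (Fin n) k) * (↑g⁻¹ : Matrix (Fin n) (Fin n) k) = 1 :=
    Units.mul_inv g
  rw [conj_mul, conj_mul]
  simp only [conj, Matrix.mul_add, Matrix.add_mul, Matrix.mul_sub, Matrix.sub_mul, Matrix.mul_one,
    h]

theorem one_conj {k : Type*} [Field k] {n : ℕ} (A : Matrix (Fin n) (Fin n) k) :
    conj 1 A = A := by
  simp [conj]

theorem mul_conj {k : Type*} [Field k] {n : ℕ} (g h : GL (Fin n) k)
    (A : Matrix (Fin n) (Fin n) k) : conj (g * h) A = conj g (conj h A) := by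
  simp only [conj, _root_.mul_inv_rev, Units.val_mul, Matrix.mul_assoc]

/-- `GL_n(k)` acts by simultaneous conjugation, `g • (X, Z) = (g X g⁻¹, g Z g⁻¹)`. -/
instance pairsAction (k : Type*) [Field k] (n : ℕ) : MulAction (GL (Fin n) k) (Pairs k n) where
  smul g p := ⟨(conj g p.1.1, conj g p.1.2), by rw [conj_comm, rank_conj]; exact p.2⟩
  one_smul p := Subtype.ext (Prod.ext (one_conj p.1.1) (one_conj p.1.2))
  mul_smul g h p := Subtype.ext (Prod.ext (mul_conj g h p.1.1) (mul_conj g h p.1.2))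

/-- Index set of the coordinates `x_{jl}` (left) and `z_{jl}` (right). -/
abbrev CoordIdx (n : ℕ) : Type := (Fin n × Fin n) ⊕ (Fin n × Fin n)

/-- The matrix entries of a pair `(X, Z)`. -/
def coords {k : Type*} [Field k] {n : ℕ} (p : Pairs k n) : CoordIdx n → k :=
  Sum.elim (fun jl => p.1.1 jl.1 jl.2) (fun jl => p.1.2 jl.1 jl.2)

/-- The coordinate ring of the space of pairs: restrictions of polynomials in the matrix entries.
(The space of pairs is Zariski closed in the space of all pairs of matrices over a field of
characteristic zero: the trace of `[X, Z] + I` is `n`, so the rank is never zero if `n > 0`.) -/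
def pairsRing (k : Type*) [Field k] (n : ℕ) : Subalgebra k (Pairs k n → k) :=
  (MvPolynomial.aeval (R := k) fun (i : CoordIdx n) (p : Pairs k n) => coords p i).range

/-- The set of orbits of `GL_n(k)` on the pairs. For `k = ℂ` these are the points of the
Calogero-Moser space `C_n`, for `k = ℝ` those of the real Calogero-Moser space `R_n`. -/
def Space (k : Type*) [Field k] (n : ℕ) : Type _ :=
  MulAction.orbitRel.Quotient (GL (Fin n) k) (Pairs k n)

/-- The quotient map: `π_n` for `k = ℂ`, `ν_n` for `k = ℝ`. -/
def proj (k : Type*) [Field k] (n : ℕ) (p : Pairs k n) : Space k n :=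
  Quotient.mk (MulAction.orbitRel (GL (Fin n) k) (Pairs k n)) p

/-- The coordinate ring of the orbit space: the functions whose pullback lies in the coordinate
ring of the space of pairs, i.e. the ring of `GL_n(k)`-invariants of the latter. -/
def spaceRing (k : Type*) [Field k] (n : ℕ) : Subalgebra k (Space k n → k) :=
  (pairsRing k n).comap (pullback k (proj k n))

/-! ### Real loci -/

theorem rank_map_ofReal {n : ℕ} (M : Matrix (Fin n) (Fin n) ℝ) :
    (M.map (Complex.ofRealHom : ℝ →+* ℂ)).rank = M.rank := by
  obtain ⟨V, U, e, hV, hU, h⟩ := M.exists_rank_normal_form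
  have hV' : IsUnit (V.map (Complex.ofRealHom : ℝ →+* ℂ)) :=
    hV.map (Complex.ofRealHom.mapMatrix (m := Fin n))
  have hU' : IsUnit (U.map (Complex.ofRealHom : ℝ →+* ℂ)) :=
    hU.map (Complex.ofRealHom.mapMatrix (m := Fin n))
  have h' := congrArg (fun N => N.map (Complex.ofRealHom : ℝ →+* ℂ)) h
  simp only [Matrix.map_mul] at h'
  have hd : (fromBlocks 1 0 0 0 : Matrix (Fin M.rank ⊕ Fin (Fintype.card (Fin n) - M.rank))
      (Fin M.rank ⊕ Fin (Fintype.card (Fin n) - M.rank)) ℂ) =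
      diagonal (Sum.elim (fun _ => 1) (fun _ => 0)) := by
    rw [← fromBlocks_diagonal, diagonal_one, diagonal_zero]
  have hc : Fintype.card {i : Fin M.rank ⊕ Fin (Fintype.card (Fin n) - M.rank) //
      (Sum.elim (fun _ => (1 : ℂ)) (fun _ => (0 : ℂ)) i) ≠ 0} = M.rank := by
    have hf : Finset.univ.filter (fun i : Fin M.rank ⊕ Fin (Fintype.card (Fin n) - M.rank) =>
        (Sum.elim (fun _ => (1 : ℂ)) (fun _ => (0 : ℂ)) i) ≠ 0) =
        Finset.univ.map Function.Embedding.inl := by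
      ext i
      rcases i with i | i <;> simp
    rw [Fintype.card_subtype, hf, Finset.card_map, Finset.card_univ, Fintype.card_fin]
  rw [← rank_mul_eq_right_of_isUnit_det _ _ ((isUnit_iff_isUnit_det _).1 hV'),
    ← rank_mul_eq_left_of_isUnit_det _ _ ((isUnit_iff_isUnit_det _).1 hU'), h',
    ← submatrix_map, rank_submatrix, fromBlocks_map, Matrix.map_one _ (map_zero _) (map_one _),
    Matrix.map_zero _ (map_zero _), Matrix.map_zero _ (map_zero _),
    Matrix.map_zero _ (map_zero _), hd, rank_diagonal, hc]

/-- The natural inclusion of the real pairs into the complex pairs. -/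
def complexify {n : ℕ} (p : Pairs ℝ n) : Pairs ℂ n :=
  ⟨(p.1.1.map (Complex.ofRealHom : ℝ →+* ℂ), p.1.2.map (Complex.ofRealHom : ℝ →+* ℂ)), by
    have h : p.1.1.map (Complex.ofRealHom : ℝ →+* ℂ) * p.1.2.map (Complex.ofRealHom : ℝ →+* ℂ) -
        p.1.2.map (Complex.ofRealHom : ℝ →+* ℂ) * p.1.1.map (Complex.ofRealHom : ℝ →+* ℂ) + 1 =
        (p.1.1 * p.1.2 - p.1.2 * p.1.1 + 1).map (Complex.ofRealHom : ℝ →+* ℂ) := by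
      ext i j
      by_cases hij : i = j <;> simp [Matrix.mul_apply, hij]
    rw [h, rank_map_ofReal]
    exact p.2⟩

/-- The real locus `RC_n` of `C_n`: the image under `π_n` of the real pairs. -/
def realLocus (n : ℕ) : Set (Space ℂ n) :=
  proj ℂ n '' Set.range (complexify : Pairs ℝ n → Pairs ℂ n)

/-- The real invariants: the functions in the coordinate ring of `C_n` (the ring of
`GL_n(ℂ)`-invariant regular functions on the complex pairs) that are given on the pairs by
polynomials with real coefficients in the matrix entries. -/
def realInvariants (n : ℕ) : Set (Space ℂ n → ℂ) :=
  {f | f ∈ spaceRing ℂ n ∧ ∃ P : MvPolynomial (CoordIdx n) ℝ,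
    ∀ p : Pairs ℂ n, f (proj ℂ n p) = MvPolynomial.aeval (coords p) P}

end RealCM

end

/-!
Let `[X, Z] + 1 = v w` with a column `v` and a row `w`. Everything rests on the invariant functions
`tr a = trace (a(X, Z) ([X, Z] + 1)) = w a(X, Z) v`, where `a` runs through the words in `x` and
`z`. They satisfy `tr 1 = n` and `tr (b (xz - zx) a) + tr (b a) = tr b * tr a` (`IsCMFunction`).

The main point is that, for any function `τ` on words with these two properties and values in a
field of characteristic zero, the infinite Gram matrix `τ (b a)` has rank at least `n`
(`IsCMFunction.exists_gram_det_ne_zero`). Indeed the letters act on the span of the columns, the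
operator `[x, z] + 1` has rank one there, and taking traces gives that the dimension of the span is
`n` if it is finite. Hence the `n × n` minors of the Gram matrix generate the unit ideal in the
algebra of the trace functions.

Where the minor with columns `a j` and rows `b i` is nonzero, the vectors `a j v` form a basis, and
in this basis the entries of `X`, `Z`, `v`, `w` are fractions of trace functions with that minor as
denominator (`exists_conj_eq_chart`). So the quotient map has sections over a cover by principal
open sets, over any field of characteristic zero. This implies that the trace functions generate
the ring of invariants, that this ring is finitely generated, that its rational points are
orbits (`exists_eq_evalAt`), and that the quotient is geometric (`isGeometricQuotient_proj`). It
also gives the real locus: if the trace functions are real at a point then so is the representative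
given by the section (`realLocus_eq`).

Smoothness over `ℝ` is inherited, via the sections, from the space of quadruples `(X, Z, v, w)`. Its
equations have surjective Jacobian, since a matrix orthogonal to the image of the differential
commutes with `X` and `Z` and kills `v`, which is a cyclic vector (`exists_right_inverse_jacobian`).
It remains to see that the equations generate, locally at a real point, the ideal of all
polynomials that vanish on the real points (`exists_mul_mem_span`). This ideal is stable under the
vector fields that annihilate the equations, because differentials of its elements vanish on tangent
vectors (Lagrange multipliers). Euler's identity then shows that it is contained in the ideal of
the equations up to any power of the maximal ideal, and Krull's intersection theorem applies.
-/

noncomputable section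

namespace RealCM

/-! ### Gram matrices of words -/

/-- Words in two letters; `of true` stands for `x` and `of false` for `z`. -/
abbrev Word : Type := FreeMonoid Bool

/-- The letter `x`. -/
def lx : Word := FreeMonoid.of true

/-- The letter `z`. -/
def lz : Word := FreeMonoid.of false

/-- The identities satisfied by the functions `τ a = w a(X, Z) v` when `[X, Z] + 1 = v w`
for `n × n` matrices `X, Z`. -/
structure IsCMFunction {R : Type*} [CommRing R] (n : ℕ) (τ : Word → R) : Prop where
  one : τ 1 = n
  comm : ∀ a b, τ (b * lx * lz * a) - τ (b * lz * lx * a) + τ (b * a) = τ b * τ a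

theorem IsCMFunction.map {R S : Type*} [CommRing R] [CommRing S] {n : ℕ} {τ : Word → R}
    (h : IsCMFunction n τ) (f : R →+* S) : IsCMFunction n (fun a => f (τ a)) where
  one := by simp [h.one]
  comm a b := by simp only [← map_mul, ← map_sub, ← map_add, h.comm]

/-- The Gram matrix of two families of words: rows are indexed by the family `b` of left factors,
columns by the family `a` of right factors. -/
def gram {R : Type*} {n : ℕ} (τ : Word → R) (a b : Fin n → Word) : Matrix (Fin n) (Fin n) R :=
  Matrix.of fun i j => τ (b i * a j)

/-- Linearly independent functions on a set have a nonzero minor: their value vectors span, and a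
basis can be chosen among them. -/
theorem exists_det_ne_zero {K ι : Type*} [Field K] {n : ℕ} (f : Fin n → ι → K)
    (hf : LinearIndependent K f) :
    ∃ b : Fin n → ι, (Matrix.of fun i j => f j (b i)).det ≠ 0 := by
  have hspan : Submodule.span K (Set.range fun (i : ι) (j : Fin n) => f j i) = ⊤ := by
    by_contra hne
    obtain ⟨φ, hφ0, hφ⟩ := Submodule.exists_le_ker_of_lt_top _ (lt_top_iff_ne_top.2 hne)
    apply hφ0
    have hc : ∀ i : ι, ∑ j, φ (Pi.single j 1) * f j i = 0 := by
      intro i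
      have h1 : φ (fun j => f j i) = 0 := hφ (Submodule.subset_span ⟨i, rfl⟩)
      rw [← h1, LinearMap.pi_apply_eq_sum_univ φ]
      refine Finset.sum_congr rfl fun j _ => ?_
      rw [smul_eq_mul, mul_comm]
      congr 2
      ext l
      simp [Pi.single_apply, eq_comm]
    have h2 := Fintype.linearIndependent_iff.1 hf (fun j => φ (Pi.single j 1)) (by
      ext i
      simpa using hc i)
    refine LinearMap.pi_ext' fun j => LinearMap.ext_ring ?_
    simpa using h2 j
  obtain ⟨κ, e, -, he, hli⟩ := exists_linearIndependent' K fun (i : ι) (j : Fin n) => f j i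
  rw [hspan] at he
  let B := Module.Basis.mk hli he.ge
  let σ := B.indexEquiv (Pi.basisFun K (Fin n))
  refine ⟨fun i => e (σ.symm i), ?_⟩
  rw [← isUnit_iff_ne_zero, ← Matrix.isUnit_iff_isUnit_det,
    ← Matrix.linearIndependent_rows_iff_isUnit]
  exact hli.comp σ.symm σ.symm.injective

/-- The words act on the span `M` of the columns `b ↦ τ (b * a)` of the infinite Gram matrix, and
the identities say that `[x, z] + 1` acts as the rank one operator `φ ↦ φ 1 • col 1`. Comparing
traces gives `dim M = n`, so that some `n × n` minor is nonzero. -/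
theorem IsCMFunction.exists_gram_det_ne_zero {K : Type*} [Field K] [CharZero K] {n : ℕ}
    {τ : Word → K} (h : IsCMFunction n τ) : ∃ a b : Fin n → Word, (gram τ a b).det ≠ 0 := by
  let col : Word → Word → K := fun a b => τ (b * a)
  obtain ⟨κ, e, -, he, hli⟩ := exists_linearIndependent' K col
  by_cases hκ : Nonempty (Fin n ↪ κ)
  · obtain ⟨g⟩ := hκ
    obtain ⟨b, hb⟩ := exists_det_ne_zero (fun j => col (e (g j))) (hli.comp g g.injective)
    exact ⟨fun j => e (g j), b, hb⟩
  exfalso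
  have hfin : Finite κ := by
    by_contra hinf
    rw [not_finite_iff_infinite] at hinf
    exact hκ ⟨Fin.valEmbedding.trans (Infinite.natEmbedding κ)⟩
  have := Fintype.ofFinite κ
  have hcard : Fintype.card κ < n := by
    by_contra hlt
    exact hκ (Function.Embedding.nonempty_of_card_le (by simpa using hlt))
  let M : Submodule K (Word → K) := Submodule.span K (Set.range col)
  have hM : M = Submodule.span K (Set.range (col ∘ e)) := he.symm
  have hrank : Module.finrank K M = Fintype.card κ := by
    rw [hM]; exact finrank_span_eq_card hli
  have : FiniteDimensional K M := by
    rw [hM]; exact FiniteDimensional.span_of_finite K (Set.finite_range _)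
  let T : Word → (Word → K) →ₗ[K] (Word → K) := fun l => LinearMap.funLeft K K fun b => b * l
  have hT : ∀ l, ∀ φ ∈ M, T l φ ∈ M := by
    intro l
    change M ≤ M.comap (T l)
    refine Submodule.span_le.2 ?_
    rintro _ ⟨a, rfl⟩
    refine Submodule.subset_span ⟨l * a, ?_⟩
    ext b
    simp [col, T, LinearMap.funLeft_apply, mul_assoc]
  let X : Module.End K M := (T lx).restrict (hT lx)
  let Z : Module.End K M := (T lz).restrict (hT lz)
  let r : M := ⟨col 1, Submodule.subset_span ⟨1, rfl⟩⟩
  let ev : M →ₗ[K] K := (LinearMap.proj (1 : Word)).comp M.subtype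
  have hXZ : X * Z + 1 = Z * X + ev.smulRight r := by
    have key : M ≤ LinearMap.ker (T lx * T lz + 1 -
        (T lz * T lx + (LinearMap.proj (1 : Word)).smulRight (col 1))) := by
      refine Submodule.span_le.2 ?_
      rintro _ ⟨a, rfl⟩
      rw [SetLike.mem_coe, LinearMap.mem_ker]
      ext b
      have := h.comm a b
      simp only [T, col, LinearMap.sub_apply, LinearMap.add_apply, Module.End.mul_apply,
        Module.End.one_apply, LinearMap.funLeft_apply, LinearMap.smulRight_apply,
        LinearMap.proj_apply, Pi.sub_apply, Pi.add_apply, Pi.smul_apply, smul_eq_mul, one_mul,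
        mul_one, Pi.zero_apply]
      linear_combination this
    refine LinearMap.ext fun φ => Subtype.ext ?_
    exact sub_eq_zero.1 (key φ.2)
  have htr := congrArg (LinearMap.trace K M) hXZ
  rw [map_add, map_add, LinearMap.trace_mul_comm, add_right_inj, LinearMap.trace_one,
    LinearMap.trace_smulRight, hrank] at htr
  have hev : ev r = n := by simp [ev, r, col, h.one]
  rw [hev] at htr
  exact hcard.ne (by exact_mod_cast htr)

/-- The minors of the Gram matrix generate the unit ideal of any `ℚ`-algebra: otherwise they would
all vanish in a residue field. -/
theorem IsCMFunction.span_gram_det {R : Type*} [CommRing R] [Algebra ℚ R] {n : ℕ}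
    {τ : Word → R} (h : IsCMFunction n τ) :
    Ideal.span (Set.range fun ab : (Fin n → Word) × (Fin n → Word) =>
      (gram τ ab.1 ab.2).det) = ⊤ := by
  by_contra hne
  obtain ⟨m, hm, hle⟩ := Ideal.exists_le_maximal _ hne
  let _ := Ideal.Quotient.field m
  have : CharZero (R ⧸ m) := algebraRat.charZero _
  obtain ⟨a, b, hab⟩ := (h.map (Ideal.Quotient.mk m)).exists_gram_det_ne_zero
  apply hab
  have h1 : (gram τ a b).det ∈ m := hle (Ideal.subset_span ⟨(a, b), rfl⟩)
  rw [← Ideal.Quotient.eq_zero_iff_mem, RingHom.map_det] at h1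
  exact h1

/-! ### Rank one matrices -/

theorem exists_eq_vecMulVec_of_rank_eq_one {K : Type*} [Field K] {n : ℕ}
    {M : Matrix (Fin n) (Fin n) K} (h : M.rank = 1) : ∃ v w : Fin n → K, M = vecMulVec v w := by
  obtain ⟨v, -, hv⟩ := finrank_eq_one_iff'.1 h
  choose w hw using fun j => hv ⟨M *ᵥ Pi.single j 1, ⟨Pi.single j 1, rfl⟩⟩
  refine ⟨v.1, w, ?_⟩
  ext i j
  have := congrFun (congrArg Subtype.val (hw j)) i
  simp only [mulVec_single_one, col_apply] at this
  rw [vecMulVec_apply, ← this, mul_comm]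
  rfl

theorem rank_eq_one_of_eq_vecMulVec {K : Type*} [Field K] {n : ℕ}
    {M : Matrix (Fin n) (Fin n) K} {v w : Fin n → K} (h : M = vecMulVec v w) (h0 : M ≠ 0) :
    M.rank = 1 := by
  refine le_antisymm (h ▸ rank_vecMulVec_le v w) (Nat.one_le_iff_ne_zero.2 fun hr => h0 ?_)
  rw [rank, Submodule.finrank_eq_zero, LinearMap.range_eq_bot] at hr
  ext i j
  simpa using congrFun (LinearMap.congr_fun hr (Pi.single j 1)) i

/-! ### The trace functions and their charts -/

/-- The value of a word at a pair of matrices. -/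
def word {R : Type*} [CommRing R] {n : ℕ} (X Z : Matrix (Fin n) (Fin n) R) :
    Word →* Matrix (Fin n) (Fin n) R :=
  FreeMonoid.lift fun b => cond b X Z

@[simp] theorem word_lx {R : Type*} [CommRing R] {n : ℕ} (X Z : Matrix (Fin n) (Fin n) R) :
    word X Z lx = X := by simp [word, lx]

@[simp] theorem word_lz {R : Type*} [CommRing R] {n : ℕ} (X Z : Matrix (Fin n) (Fin n) R) :
    word X Z lz = Z := by simp [word, lz]

theorem word_map {R S : Type*} [CommRing R] [CommRing S] {n : ℕ}
    (X Z : Matrix (Fin n) (Fin n) R) (f : Matrix (Fin n) (Fin n) R →* Matrix (Fin n) (Fin n) S)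
    (a : Word) : f (word X Z a) = word (f X) (f Z) a := by
  have : f.comp (word X Z) = word (f X) (f Z) :=
    FreeMonoid.hom_eq fun b => by cases b <;> simp [word]
  exact DFunLike.congr_fun this a

theorem commute_word {R : Type*} [CommRing R] {n : ℕ} {X Z Y : Matrix (Fin n) (Fin n) R}
    (hX : Y * X = X * Y) (hZ : Y * Z = Z * Y) (a : Word) : Y * word X Z a = word X Z a * Y := by
  induction a using FreeMonoid.inductionOn' with
  | one => simp
  | of_mul b a ih =>
    have hb : Y * word X Z (FreeMonoid.of b) = word X Z (FreeMonoid.of b) * Y := by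
      cases b <;> simpa [word]
    rw [map_mul, ← mul_assoc, hb, mul_assoc, ih, mul_assoc]

/-- `[X, Z] + 1`. -/
def moment {R : Type*} [CommRing R] {n : ℕ} (X Z : Matrix (Fin n) (Fin n) R) :
    Matrix (Fin n) (Fin n) R := X * Z - Z * X + 1

/-- The conjugation invariant function `tr (a(X, Z) ([X, Z] + 1))` of a pair of matrices. -/
def tr {R : Type*} [CommRing R] {n : ℕ} (X Z : Matrix (Fin n) (Fin n) R) (a : Word) : R :=
  (word X Z a * moment X Z).trace

theorem map_tr {R S : Type*} [CommRing R] [CommRing S] {n : ℕ}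
    (X Z : Matrix (Fin n) (Fin n) R) (f : R →+* S) (a : Word) :
    f (tr X Z a) = tr (f.mapMatrix X) (f.mapMatrix Z) a := by
  have h1 : f.mapMatrix (word X Z a) = word (f.mapMatrix X) (f.mapMatrix Z) a :=
    word_map X Z f.mapMatrix.toMonoidHom a
  rw [tr, tr, moment, moment, ← h1, ← map_mul, ← map_mul, ← map_sub,
    ← map_one (f.mapMatrix (m := Fin n)), ← map_add, ← map_mul]
  exact AddMonoidHom.map_trace f.toAddMonoidHom _

theorem tr_eq {R : Type*} [CommRing R] {n : ℕ} {X Z : Matrix (Fin n) (Fin n) R}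
    {v w : Fin n → R} (h : moment X Z = vecMulVec v w) (a : Word) :
    tr X Z a = w ⬝ᵥ (word X Z a *ᵥ v) := by
  rw [tr, h, mul_vecMulVec, trace_vecMulVec, dotProduct_comm]

theorem isCMFunction_tr {R : Type*} [CommRing R] {n : ℕ} {X Z : Matrix (Fin n) (Fin n) R}
    {v w : Fin n → R} (h : moment X Z = vecMulVec v w) : IsCMFunction n (tr X Z) where
  one := by simp [tr, moment, trace_sub, trace_mul_comm X Z]
  comm a b := by
    have h1 : word X Z (b * lx * lz * a) - word X Z (b * lz * lx * a) + word X Z (b * a) =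
        word X Z b * moment X Z * word X Z a := by
      simp only [map_mul, word_lx, word_lz, moment]
      noncomm_ring
    rw [tr, tr, tr, ← trace_sub, ← trace_add, ← sub_mul, ← add_mul, h1, tr_eq h, tr_eq h, h,
      mul_vecMulVec, trace_vecMulVec, ← mulVec_mulVec, ← mulVec_mulVec, vecMulVec_mulVec,
      mulVec_smul, smul_dotProduct, dotProduct_comm _ w]
    simp [mul_comm]

/-- Coordinates on quadruples `(X, Z, v, w)` of two matrices, a column and a row. -/
abbrev QuadIdx (n : ℕ) : Type := CoordIdx n ⊕ (Fin n ⊕ Fin n)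

/-- Numerators of the chart belonging to two families `a`, `b` of words. When `τ` consists of the
trace functions of a quadruple `(X, Z, v, w)` with `[X, Z] + 1 = v w`, and the columns `a j v` form
a basis, then after division by the Gram determinant these are the coordinates of the
quadruple in that basis. -/
def chartNum {R : Type*} [CommRing R] {n : ℕ} (τ : Word → R) (a b : Fin n → Word) :
    QuadIdx n → R :=
  Sum.elim
    (Sum.elim
      (fun ij => ((gram τ a b).adjugate * gram τ (fun j => lx * a j) b) ij.1 ij.2)
      (fun ij => ((gram τ a b).adjugate * gram τ (fun j => lz * a j) b) ij.1 ij.2))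
    (Sum.elim
      (fun i => ((gram τ a b).adjugate *ᵥ fun i => τ (b i)) i)
      (fun j => (gram τ a b).det * τ (a j)))

theorem map_gram {R S : Type*} [CommRing R] [CommRing S] {n : ℕ} (f : R →+* S) (τ : Word → R)
    (a b : Fin n → Word) : f.mapMatrix (gram τ a b) = gram (fun w => f (τ w)) a b := rfl

theorem map_gram_det {R S : Type*} [CommRing R] [CommRing S] {n : ℕ} (f : R →+* S)
    (τ : Word → R) (a b : Fin n → Word) :
    f (gram τ a b).det = (gram (fun w => f (τ w)) a b).det := by
  rw [RingHom.map_det, map_gram]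

theorem map_chartNum {R S : Type*} [CommRing R] [CommRing S] {n : ℕ} (f : R →+* S)
    (τ : Word → R) (a b : Fin n → Word) (s : QuadIdx n) :
    f (chartNum τ a b s) = chartNum (fun w => f (τ w)) a b s := by
  have h : f.mapMatrix (gram τ a b).adjugate = (gram (fun w => f (τ w)) a b).adjugate := by
    rw [RingHom.map_adjugate, map_gram]
  rcases s with (⟨i, j⟩ | ⟨i, j⟩) | (i | j)
  · exact (congrFun (congrFun (map_mul f.mapMatrix _ _) i) j).trans (by rw [h]; rfl)
  · exact (congrFun (congrFun (map_mul f.mapMatrix _ _) i) j).trans (by rw [h]; rfl)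
  · simp only [chartNum, Sum.elim_inr, Sum.elim_inl, ← h]
    exact RingHom.map_mulVec f _ _ i
  · simp only [chartNum, Sum.elim_inr, map_mul, map_gram_det]

/-- The coordinates of a quadruple. -/
def quadCoords {R : Type*} {n : ℕ} (X Z : Matrix (Fin n) (Fin n) R) (v w : Fin n → R) :
    QuadIdx n → R :=
  Sum.elim (Sum.elim (fun ij => X ij.1 ij.2) (fun ij => Z ij.1 ij.2)) (Sum.elim v w)

theorem mul_word_mul_eq_gram {R : Type*} [CommRing R] {n : ℕ} {X Z : Matrix (Fin n) (Fin n) R}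
    {v w : Fin n → R} (h : moment X Z = vecMulVec v w) (a b : Fin n → Word) (c : Word) :
    (Matrix.of fun i => w ᵥ* word X Z (b i)) * word X Z c *
      (Matrix.of fun i j => (word X Z (a j) *ᵥ v) i) =
        gram (tr X Z) (fun j => c * a j) b := by
  ext i j
  have : gram (tr X Z) (fun j => c * a j) b i j =
      (w ᵥ* word X Z (b i)) ⬝ᵥ (word X Z c *ᵥ (word X Z (a j) *ᵥ v)) := by
    change tr X Z (b i * (c * a j)) = _
    rw [tr_eq h, map_mul, map_mul, ← mulVec_mulVec, dotProduct_mulVec, ← mulVec_mulVec]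
  rw [this, mul_assoc]
  rfl

/-- Where the Gram determinant is nonzero, dividing the numerators of the chart by it gives a
conjugate of the given quadruple. The conjugation is by the matrix with columns `a j v`. -/
theorem exists_conj_eq_chart {K : Type*} [Field K] {n : ℕ} {X Z : Matrix (Fin n) (Fin n) K}
    {v w : Fin n → K} (h : moment X Z = vecMulVec v w) (a b : Fin n → Word)
    (hd : (gram (tr X Z) a b).det ≠ 0) :
    ∃ (g : GL (Fin n) K) (v' w' : Fin n → K), moment (conj g X) (conj g Z) = vecMulVec v' w' ∧
      ∀ s, quadCoords (conj g X) (conj g Z) v' w' s =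
        chartNum (tr X Z) a b s / (gram (tr X Z) a b).det := by
  set G := gram (tr X Z) a b with hG
  let P : Matrix (Fin n) (Fin n) K := Matrix.of fun i j => (word X Z (a j) *ᵥ v) i
  let Q : Matrix (Fin n) (Fin n) K := Matrix.of fun i => w ᵥ* word X Z (b i)
  have hQP : ∀ c : Word, Q * word X Z c * P = gram (tr X Z) (fun j => c * a j) b :=
    mul_word_mul_eq_gram h a b
  have hG1 : G = Q * P := by simpa using (hQP 1).symm
  have hu : IsUnit P.det := by
    refine isUnit_iff_ne_zero.2 fun h0 => hd ?_
    rw [hG1, det_mul, h0, mul_zero]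
  have huQ : IsUnit Q.det := by
    refine isUnit_iff_ne_zero.2 fun h0 => hd ?_
    rw [hG1, det_mul, h0, zero_mul]
  have hGinv : P⁻¹ = G⁻¹ * Q := by
    rw [hG1, Matrix.mul_inv_rev, mul_assoc, nonsing_inv_mul _ huQ, mul_one]
  have hinv : G⁻¹ = G.det⁻¹ • G.adjugate := by rw [Matrix.inv_def, Ring.inverse_eq_inv']
  let g : GL (Fin n) K := (P.nonsingInvUnit hu)⁻¹
  have hg : ∀ M, conj g M = P⁻¹ * M * P := fun M => rfl
  have key : ∀ c, conj g (word X Z c) =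
      G.det⁻¹ • (G.adjugate * gram (tr X Z) (fun j => c * a j) b) := by
    intro c
    rw [hg, hGinv, mul_assoc, mul_assoc, ← mul_assoc Q, hQP, hinv, smul_mul_assoc]
  refine ⟨g, P⁻¹ *ᵥ v, w ᵥ* P, ?_, ?_⟩
  · rw [moment, conj_comm]
    change conj g (moment X Z) = _
    rw [h, hg, mul_vecMulVec, vecMulVec_mul]
  · have hX := key lx
    have hZ := key lz
    rw [word_lx] at hX
    rw [word_lz] at hZ
    rintro ((⟨i, j⟩ | ⟨i, j⟩) | (i | j))
    · simp [quadCoords, chartNum, hX, ← hG, div_eq_inv_mul]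
    · simp [quadCoords, chartNum, hZ, ← hG, div_eq_inv_mul]
    · have hv : Q *ᵥ v = fun i => tr X Z (b i) := by
        ext i
        rw [tr_eq h, dotProduct_mulVec]
        rfl
      rw [hGinv, ← mulVec_mulVec, hv, hinv, smul_mulVec]
      simp [quadCoords, chartNum, ← hG, div_eq_inv_mul]
    · have hw : w ᵥ* P = fun j => tr X Z (a j) := by
        ext j
        rw [tr_eq h]
        rfl
      simp [quadCoords, chartNum, hw, ← hG, hd]

/-! ### Invariant functions -/

/-- Clearing denominators: `d ^ m * F (N / d)` for an exponent `m` that depends only on `F`,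
uniformly for all algebras in which `d` becomes invertible. -/
theorem exists_clear_denominators.{u} {k A : Type u} [CommRing k] [CommRing A] [Algebra k A]
    {σ : Type*} (N : σ → A) (d : A) (F : MvPolynomial σ k) :
    ∃ (m : ℕ) (h : A), ∀ (B : Type u) [CommRing B] [Algebra k B] (χ : A →ₐ[k] B) (u : B),
      χ d * u = 1 → χ h = χ d ^ m * MvPolynomial.aeval (fun s => χ (N s) * u) F := by
  induction F using MvPolynomial.induction_on with
  | C r => exact ⟨0, algebraMap k A r, fun B _ _ χ u hu => by simp⟩
  | add p q hp hq =>
    obtain ⟨m, h, H⟩ := hp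
    obtain ⟨m', h', H'⟩ := hq
    refine ⟨m + m', d ^ m' * h + d ^ m * h', fun B _ _ χ u hu => ?_⟩
    simp only [map_add, map_mul, map_pow, H B χ u hu, H' B χ u hu]
    ring
  | mul_X p s hp =>
    obtain ⟨m, h, H⟩ := hp
    refine ⟨m + 1, h * N s, fun B _ _ χ u hu => ?_⟩
    simp only [map_mul, MvPolynomial.aeval_X, H B χ u hu]
    linear_combination
      (- χ d ^ m * MvPolynomial.aeval (fun s => χ (N s) * u) p * χ (N s)) * hu

section Invariants

variable {K : Type*} [Field K] {n : ℕ}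

theorem mem_pairsRing {f : Pairs K n → K} :
    f ∈ pairsRing K n ↔
      ∃ F : MvPolynomial (CoordIdx n) K, ∀ p, f p = MvPolynomial.aeval (coords p) F := by
  have h : ∀ (F : MvPolynomial (CoordIdx n) K) (p : Pairs K n),
      MvPolynomial.aeval (R := K) (fun (i : CoordIdx n) (p : Pairs K n) => coords p i) F p =
        MvPolynomial.aeval (coords p) F := by
    intro F p
    exact (MvPolynomial.comp_aeval_apply _
      (Pi.evalAlgHom K (fun _ : Pairs K n => K) p) F).trans rfl
  constructor
  · rintro ⟨F, rfl⟩
    exact ⟨F, h F⟩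
  · rintro ⟨F, hF⟩
    exact ⟨F, funext fun p => (h F p).trans (hF p).symm⟩

theorem mem_spaceRing {f : Space K n → K} :
    f ∈ spaceRing K n ↔
      ∃ F : MvPolynomial (CoordIdx n) K, ∀ p, f (proj K n p) = MvPolynomial.aeval (coords p) F :=
  mem_pairsRing (f := f ∘ proj K n)

theorem proj_surjective : Function.Surjective (proj K n) := Quotient.mk_surjective

theorem proj_eq_iff {p q : Pairs K n} :
    proj K n p = proj K n q ↔ ∃ g : GL (Fin n) K, g • p = q := by
  refine Quotient.eq.trans ?_
  refine (MulAction.orbitRel_apply).trans ⟨?_, ?_⟩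
  · rintro ⟨g, rfl⟩
    exact ⟨g⁻¹, inv_smul_smul g q⟩
  · rintro ⟨g, rfl⟩
    exact ⟨g⁻¹, inv_smul_smul g p⟩

theorem exists_moment_eq (p : Pairs K n) : ∃ v w, moment p.1.1 p.1.2 = vecMulVec v w :=
  exists_eq_vecMulVec_of_rank_eq_one p.2

theorem coords_injective : Function.Injective (coords : Pairs K n → CoordIdx n → K) := by
  intro p q h
  refine Subtype.ext (Prod.ext ?_ ?_)
  · ext i j; exact congrFun h (Sum.inl (i, j))
  · ext i j; exact congrFun h (Sum.inr (i, j))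

theorem tr_conj (g : GL (Fin n) K) (X Z : Matrix (Fin n) (Fin n) K) (a : Word) :
    tr (conj g X) (conj g Z) a = tr X Z a := by
  have h1 : conj g (word X Z a) = word (conj g X) (conj g Z) a :=
    word_map X Z
      { toFun := conj g
        map_one' := by simp [conj]
        map_mul' := fun A B => (conj_mul g A B).symm } a
  rw [tr, tr, ← h1, moment, conj_comm, conj_mul, conj, trace_mul_comm, ← mul_assoc,
    Units.inv_mul, one_mul, moment]

/-- The polynomial in the entries of a generic pair of matrices that gives the trace function of a
word. -/
def genericTr (R : Type*) [CommRing R] (n : ℕ) (a : Word) : MvPolynomial (CoordIdx n) R :=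
  tr (Matrix.of fun i j => MvPolynomial.X (Sum.inl (i, j)))
    (Matrix.of fun i j => MvPolynomial.X (Sum.inr (i, j))) a

theorem aeval_genericTr {R : Type*} [CommRing R] [Algebra R K] (a : Word) (p : Pairs K n) :
    MvPolynomial.aeval (coords p) (genericTr R n a) = tr p.1.1 p.1.2 a := by
  refine (map_tr _ _ (MvPolynomial.aeval (R := R) (coords p)).toRingHom a).trans ?_
  congr 1 <;> ext i j <;> simp [coords]

/-- The function `tr (a(X, Z) ([X, Z] + 1))` on the orbit space. -/
def trS (K : Type*) [Field K] (n : ℕ) (a : Word) : Space K n → K :=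
  Quotient.lift (fun p : Pairs K n => tr p.1.1 p.1.2 a) (by
    rintro _ q ⟨g, rfl⟩
    exact tr_conj g q.1.1 q.1.2 a)

theorem trS_proj (a : Word) (p : Pairs K n) : trS K n a (proj K n p) = tr p.1.1 p.1.2 a := rfl

theorem trS_mem (a : Word) : trS K n a ∈ spaceRing K n :=
  mem_spaceRing.2 ⟨genericTr K n a, fun p => (aeval_genericTr a p).symm⟩

theorem isCMFunction_trS : IsCMFunction n (trS K n) where
  one := by
    ext c
    obtain ⟨p, rfl⟩ := proj_surjective c
    obtain ⟨v, w, h⟩ := exists_moment_eq p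
    exact (isCMFunction_tr h).one
  comm a b := by
    ext c
    obtain ⟨p, rfl⟩ := proj_surjective c
    obtain ⟨v, w, h⟩ := exists_moment_eq p
    exact (isCMFunction_tr h).comm a b

variable (K) in
/-- The Gram determinant of a chart. -/
def chartDet (a b : Fin n → Word) : Space K n → K := (gram (trS K n) a b).det

theorem chartDet_apply (a b : Fin n → Word) (c : Space K n) :
    chartDet K a b c = (gram (fun w => trS K n w c) a b).det :=
  map_gram_det (Pi.evalRingHom (fun _ => K) c) _ a b

theorem chartNum_apply (a b : Fin n → Word) (s : QuadIdx n) (c : Space K n) :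
    chartNum (trS K n) a b s c = chartNum (fun w => trS K n w c) a b s :=
  map_chartNum (Pi.evalRingHom (fun _ => K) c) _ a b s

theorem chartDet_mem {T : Subalgebra K (Space K n → K)} (hT : ∀ a, trS K n a ∈ T)
    (a b : Fin n → Word) : chartDet K a b ∈ T := by
  have := map_gram_det T.val.toRingHom (fun a => ⟨trS K n a, hT a⟩) a b
  rw [chartDet]
  exact this ▸ Subtype.property _

theorem chartNum_mem {T : Subalgebra K (Space K n → K)} (hT : ∀ a, trS K n a ∈ T)
    (a b : Fin n → Word) (s : QuadIdx n) : chartNum (trS K n) a b s ∈ T := by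
  have := map_chartNum T.val.toRingHom (fun a => ⟨trS K n a, hT a⟩) a b s
  exact this ▸ Subtype.property _

variable (K) in
/-- The coordinates of the chart: a quadruple over each point with nonzero Gram determinant. -/
def chart (a b : Fin n → Word) (c : Space K n) : QuadIdx n → K :=
  fun s => chartNum (trS K n) a b s c * (chartDet K a b c)⁻¹

/-- The equations `[X, Z] + 1 = v w` in the coordinates of a quadruple. -/
def quadEqn (R : Type*) [CommRing R] {n : ℕ} (ij : Fin n × Fin n) : MvPolynomial (QuadIdx n) R :=
  moment (Matrix.of fun i j => MvPolynomial.X (Sum.inl (Sum.inl (i, j))))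
    (Matrix.of fun i j => MvPolynomial.X (Sum.inl (Sum.inr (i, j)))) ij.1 ij.2 -
  MvPolynomial.X (Sum.inr (Sum.inl ij.1)) * MvPolynomial.X (Sum.inr (Sum.inr ij.2))

/-- The first matrix of a quadruple. -/
def quadX {R : Type*} {n : ℕ} (y : QuadIdx n → R) : Matrix (Fin n) (Fin n) R :=
  Matrix.of fun i j => y (Sum.inl (Sum.inl (i, j)))

/-- The second matrix of a quadruple. -/
def quadZ {R : Type*} {n : ℕ} (y : QuadIdx n → R) : Matrix (Fin n) (Fin n) R :=
  Matrix.of fun i j => y (Sum.inl (Sum.inr (i, j)))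

/-- The column of a quadruple. -/
def quadV {R : Type*} {n : ℕ} (y : QuadIdx n → R) : Fin n → R := fun i => y (Sum.inr (Sum.inl i))

/-- The row of a quadruple. -/
def quadW {R : Type*} {n : ℕ} (y : QuadIdx n → R) : Fin n → R := fun i => y (Sum.inr (Sum.inr i))

theorem aeval_quadEqn {R S : Type*} [CommRing R] [CommRing S] [Algebra R S] {n : ℕ}
    (y : QuadIdx n → S) (ij : Fin n × Fin n) :
    MvPolynomial.aeval y (quadEqn R ij) =
      (moment (quadX y) (quadZ y) - vecMulVec (quadV y) (quadW y)) ij.1 ij.2 := by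
  simp [quadEqn, moment, quadX, quadZ, quadV, quadW, Matrix.mul_apply, Matrix.one_apply,
    vecMulVec_apply, apply_ite (MvPolynomial.aeval y)]

theorem moment_eq_of_aeval_quadEqn {R S : Type*} [CommRing R] [CommRing S] [Algebra R S] {n : ℕ}
    {y : QuadIdx n → S} (h : ∀ ij, MvPolynomial.aeval y (quadEqn R ij) = 0) :
    moment (quadX y) (quadZ y) = vecMulVec (quadV y) (quadW y) := by
  ext i j
  have := h (i, j)
  rw [aeval_quadEqn] at this
  exact sub_eq_zero.1 this

/-- A zero of the equations gives a pair: the rank of `[X, Z] + 1` is at most one, and it is not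
zero since the trace is `n`. -/
theorem exists_pair_of_aeval_quadEqn [CharZero K] (hn : n ≠ 0) {y : QuadIdx n → K}
    (h : ∀ ij, MvPolynomial.aeval y (quadEqn K ij) = 0) :
    ∃ p : Pairs K n, ∀ s, coords p s = y (Sum.inl s) := by
  have h1 := moment_eq_of_aeval_quadEqn h
  refine ⟨⟨(quadX y, quadZ y), rank_eq_one_of_eq_vecMulVec h1 fun h0 => hn ?_⟩, ?_⟩
  · have := congrArg trace h0
    rw [trace_add, trace_sub, trace_mul_comm, sub_self, zero_add, trace_one, trace_zero,
      Fintype.card_fin] at this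
    exact_mod_cast this
  · rintro (⟨i, j⟩ | ⟨i, j⟩) <;> rfl

/-- Where its Gram determinant is nonzero, a chart gives a section of the quotient map. -/
theorem exists_pair_chart (a b : Fin n → Word) {c : Space K n} (hd : chartDet K a b c ≠ 0) :
    ∃ p : Pairs K n, proj K n p = c ∧ (∀ s, coords p s = chart K a b c (Sum.inl s)) ∧
      ∀ ij, MvPolynomial.aeval (chart K a b c) (quadEqn K ij) = 0 := by
  obtain ⟨p, rfl⟩ := proj_surjective c
  obtain ⟨v, w, h⟩ := exists_moment_eq p
  rw [chartDet_apply] at hd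
  obtain ⟨g, v', w', h', hq⟩ := exists_conj_eq_chart h a b hd
  have hq' : quadCoords (conj g p.1.1) (conj g p.1.2) v' w' = chart K a b (proj K n p) := by
    ext s
    rw [hq, chart, div_eq_mul_inv, chartDet_apply, chartNum_apply]
    rfl
  refine ⟨g • p, (proj_eq_iff.2 ⟨g, rfl⟩).symm, fun s => ?_, fun ij => ?_⟩
  · rw [← hq']
    rcases s with ⟨i, j⟩ | ⟨i, j⟩ <;> rfl
  · rw [aeval_quadEqn, ← hq']
    exact congrFun (congrFun (sub_eq_zero.2 h') ij.1) ij.2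

/-- If charts cover the orbit space in the strong sense that their Gram determinants generate the
unit ideal of a subalgebra `T` that contains their coordinates, then `T` contains all
invariants: in each chart an invariant polynomial is a fraction with numerator in `T`. -/
theorem spaceRing_le {ι : Type*} (T : Subalgebra K (Space K n → K)) (t : Finset ι)
    (a b : ι → Fin n → Word) (e : ι → Space K n → K) (he : ∀ i ∈ t, e i ∈ T)
    (hd : ∀ i ∈ t, chartDet K (a i) (b i) ∈ T)
    (hN : ∀ i ∈ t, ∀ s, chartNum (trS K n) (a i) (b i) s ∈ T)
    (hsum : ∑ i ∈ t, e i * chartDet K (a i) (b i) = 1) : spaceRing K n ≤ T := by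
  intro f hf
  obtain ⟨F, hF⟩ := mem_spaceRing.1 hf
  let I : Ideal T :=
    { carrier := {u | u.1 * f ∈ T}
      zero_mem' := by simp
      add_mem' := fun {u v} hu hv => by
        simp only [Set.mem_ofPred_eq, Subalgebra.coe_add, add_mul] at *
        exact add_mem hu hv
      smul_mem' := fun r u hu => by
        simp only [Set.mem_ofPred_eq, smul_eq_mul, Subalgebra.coe_mul, mul_assoc] at *
        exact mul_mem r.2 hu }
  have hrad : ∀ i (hi : i ∈ t), (⟨chartDet K (a i) (b i), hd i hi⟩ : T) ∈ I.radical := by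
    intro i hi
    obtain ⟨m, h, H⟩ := exists_clear_denominators (A := T)
      (fun s : CoordIdx n => ⟨chartNum (trS K n) (a i) (b i) (Sum.inl s), hN i hi _⟩)
      ⟨chartDet K (a i) (b i), hd i hi⟩ F
    refine ⟨m + 1, ?_⟩
    change chartDet K (a i) (b i) ^ (m + 1) * f ∈ T
    have : chartDet K (a i) (b i) ^ (m + 1) * f = chartDet K (a i) (b i) * h.1 := by
      ext c
      by_cases h0 : chartDet K (a i) (b i) c = 0
      · simp [h0]
      · obtain ⟨p, hp, hpc, -⟩ := exists_pair_chart (a i) (b i) h0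
        have h1 := H K (evalAt T c) _ (mul_inv_cancel₀ h0)
        have h2 : MvPolynomial.aeval (coords p) F = f c := by rw [← hp, hF]
        rw [funext hpc] at h2
        change h.1 c = chartDet K (a i) (b i) c ^ m *
          MvPolynomial.aeval (fun s => chart K (a i) (b i) c (Sum.inl s)) F at h1
        simp only [Pi.mul_apply, Pi.pow_apply, h1, h2]
        ring
    rw [this]
    exact mul_mem (hd i hi) h.2
  have h1 : (1 : T) ∈ I.radical := by
    have : (1 : T) = ∑ i ∈ t.attach, ⟨e i.1, he i.1 i.2⟩ *
        ⟨chartDet K (a i.1) (b i.1), hd i.1 i.2⟩ := by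
      apply Subtype.ext
      rw [AddSubmonoidClass.coe_finsetSum]
      exact (hsum.symm.trans (Finset.sum_attach t _).symm)
    rw [this]
    exact Ideal.sum_mem _ fun i _ => Ideal.mul_mem_left _ _ (hrad i.1 i.2)
  have h2 : (1 : T) ∈ I := by
    rw [← Ideal.eq_top_iff_one, ← Ideal.radical_eq_top, Ideal.eq_top_iff_one]
    exact h1
  have h3 : (1 : Space K n → K) * f ∈ T := h2
  rwa [one_mul] at h3

variable [CharZero K]

theorem exists_chartDet_ne_zero (c : Space K n) :
    ∃ a b : Fin n → Word, chartDet K a b c ≠ 0 := by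
  simp only [chartDet_apply]
  exact (isCMFunction_trS.map (Pi.evalRingHom (fun _ => K) c)).exists_gram_det_ne_zero

/-- The orbit space is separated by the trace functions. -/
theorem eq_of_trS_eq {c c' : Space K n} (h : ∀ a, trS K n a c = trS K n a c') : c = c' := by
  obtain ⟨a, b, hd⟩ := exists_chartDet_ne_zero c
  have ht : (fun w => trS K n w c) = fun w => trS K n w c' := funext h
  have hdd : chartDet K a b c' = chartDet K a b c := by rw [chartDet_apply, chartDet_apply, ht]
  have hc : chart K a b c' = chart K a b c := by
    ext s
    rw [chart, chart, hdd, chartNum_apply, chartNum_apply, ht]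
  obtain ⟨p, rfl, hp, -⟩ := exists_pair_chart a b hd
  obtain ⟨p', rfl, hp', -⟩ := exists_pair_chart a b (hdd ▸ hd)
  congr 1
  refine coords_injective (funext fun s => ?_)
  rw [hp, hp', hc]

variable (K n) in
/-- Finitely many Gram determinants generate the unit ideal of the algebra generated by
the trace functions. -/
theorem exists_sum_chartDet_eq_one :
    ∃ (t : Finset ((Fin n → Word) × (Fin n → Word)))
      (e : (Fin n → Word) × (Fin n → Word) → Space K n → K),
      (∀ i, e i ∈ Algebra.adjoin K (Set.range (trS K n))) ∧
        ∑ i ∈ t, e i * chartDet K i.1 i.2 = 1 := by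
  let T := Algebra.adjoin K (Set.range (trS K n))
  have hT : ∀ a, trS K n a ∈ T := fun a => Algebra.subset_adjoin ⟨a, rfl⟩
  let τ : Word → T := fun a => ⟨trS K n a, hT a⟩
  have hτ : IsCMFunction n τ :=
    ⟨Subtype.ext isCMFunction_trS.one, fun a b => Subtype.ext (isCMFunction_trS.comm a b)⟩
  have h1 : (1 : T) ∈ Ideal.span (Set.range fun ab : (Fin n → Word) × (Fin n → Word) =>
      (gram τ ab.1 ab.2).det) := by
    rw [hτ.span_gram_det]; trivial
  obtain ⟨e, he⟩ := Finsupp.mem_ideal_span_range_iff_exists_finsupp.1 h1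
  refine ⟨e.support, fun i => (e i).1, fun i => (e i).2, ?_⟩
  have := congrArg T.val he
  rw [Finsupp.sum, map_sum, map_one] at this
  rw [← this]
  refine Finset.sum_congr rfl fun i _ => ?_
  rw [map_mul]
  congr 1
  exact (map_gram_det T.val.toRingHom τ i.1 i.2).symm

theorem spaceRing_eq_adjoin : spaceRing K n = Algebra.adjoin K (Set.range (trS K n)) := by
  have hT : ∀ a, trS K n a ∈ Algebra.adjoin K (Set.range (trS K n)) :=
    fun a => Algebra.subset_adjoin ⟨a, rfl⟩
  obtain ⟨t, e, he, hsum⟩ := exists_sum_chartDet_eq_one K n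
  refine le_antisymm ?_ (Algebra.adjoin_le ?_)
  · exact spaceRing_le _ t _ _ e (fun i _ => he i) (fun i _ => chartDet_mem hT _ _)
      (fun i _ s => chartNum_mem hT _ _ s) hsum
  · rintro _ ⟨a, rfl⟩
    exact trS_mem a

theorem spaceRing_fg : (spaceRing K n).FG := by
  obtain ⟨t, e, he, hsum⟩ := exists_sum_chartDet_eq_one K n
  let S : Set (Space K n → K) := ⋃ i ∈ t, ({e i, chartDet K i.1 i.2} ∪
    Set.range (chartNum (trS K n) i.1 i.2))
  have hS : S.Finite := Set.Finite.biUnion t.finite_toSet fun i _ =>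
    (Set.toFinite _).union (Set.finite_range _)
  have hmem : ∀ i ∈ t, ({e i, chartDet K i.1 i.2} ∪ Set.range (chartNum (trS K n) i.1 i.2) :
      Set (Space K n → K)) ⊆ Algebra.adjoin K S :=
    fun i hi => (Set.subset_biUnion_of_mem (u := fun i => ({e i, chartDet K i.1 i.2} ∪
      Set.range (chartNum (trS K n) i.1 i.2) : Set (Space K n → K))) hi).trans
        Algebra.subset_adjoin
  rw [Subalgebra.fg_def]
  refine ⟨S, hS, le_antisymm (Algebra.adjoin_le ?_) ?_⟩
  · refine Set.iUnion₂_subset fun i _ => Set.union_subset (Set.insert_subset_iff.2 ⟨?_,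
      Set.singleton_subset_iff.2 (chartDet_mem trS_mem _ _)⟩) ?_
    · rw [SetLike.mem_coe, spaceRing_eq_adjoin]
      exact he i
    · rintro _ ⟨s, rfl⟩
      exact chartNum_mem trS_mem _ _ s
  · exact spaceRing_le _ t _ _ e (fun i hi => hmem i hi (by simp))
      (fun i hi => hmem i hi (by simp)) (fun i hi s => hmem i hi (Or.inr ⟨s, rfl⟩)) hsum

end Invariants

section Quotient

variable {K : Type*} [Field K] {n : ℕ}

/-! ### Points of the orbit space -/

/-- Two ways to evaluate a polynomial in the coordinates of a quadruple at a point `χ` of the ring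
of invariants at which the Gram determinant `chartDet K a b` is invertible: if the polynomial
agrees on the chart with an invariant `f`, then it takes the value `χ f`. -/
theorem aeval_chartNum_eq.{u} {K : Type u} [Field K] {n : ℕ} (a b : Fin n → Word)
    (F : MvPolynomial (QuadIdx n) K) (f : spaceRing K n)
    (hf : ∀ c, chartDet K a b c ≠ 0 → MvPolynomial.aeval (chart K a b c) F = f.1 c)
    {B : Type u} [CommRing B] [Algebra K B] (χ : spaceRing K n →ₐ[K] B) (u : B)
    (hu : χ ⟨chartDet K a b, chartDet_mem trS_mem a b⟩ * u = 1) :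
    MvPolynomial.aeval
      (fun s => χ ⟨chartNum (trS K n) a b s, chartNum_mem trS_mem a b s⟩ * u) F = χ f := by
  set d : spaceRing K n := ⟨chartDet K a b, chartDet_mem trS_mem a b⟩
  obtain ⟨m, h, H⟩ := exists_clear_denominators
    (fun s => (⟨chartNum (trS K n) a b s, chartNum_mem trS_mem a b s⟩ : spaceRing K n)) d F
  have h1 : d * h = d * (d ^ m * f) := by
    ext c
    change chartDet K a b c * h.1 c = chartDet K a b c * (chartDet K a b c ^ m * f.1 c)
    by_cases h0 : chartDet K a b c = 0
    · rw [h0, zero_mul, zero_mul]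
    · rw [← hf c h0]
      exact congrArg _ (H K (evalAt _ c) _ (mul_inv_cancel₀ h0))
  have h2 := congrArg χ h1
  have hunit : IsUnit (χ d) := IsUnit.of_mul_eq_one _ hu
  rw [map_mul, map_mul, map_mul, map_pow, hunit.mul_right_inj, H B χ u hu,
    (hunit.pow m).mul_right_inj] at h2
  exact h2

/-- In each chart, an element of the coordinate ring of the pairs becomes a fraction of
invariant functions. -/
theorem exists_chart_fraction (a b : Fin n → Word) {f : Pairs K n → K} (hf : f ∈ pairsRing K n) :
    ∃ (m : ℕ) (h : spaceRing K n), ∀ p : Pairs K n, chartDet K a b (proj K n p) ≠ 0 →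
      (∀ s, coords p s = chart K a b (proj K n p) (Sum.inl s)) →
        h.1 (proj K n p) = chartDet K a b (proj K n p) ^ m * f p := by
  obtain ⟨F, hF⟩ := mem_pairsRing.1 hf
  obtain ⟨m, h, H⟩ := exists_clear_denominators (A := spaceRing K n)
    (fun s : CoordIdx n => ⟨chartNum (trS K n) a b (Sum.inl s), chartNum_mem trS_mem _ _ _⟩)
    ⟨chartDet K a b, chartDet_mem trS_mem _ _⟩ F
  refine ⟨m, h, fun p h0 hp => ?_⟩
  have h1 := H K (evalAt (spaceRing K n) (proj K n p)) _ (mul_inv_cancel₀ h0)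
  rw [hF p, funext hp]
  exact h1

variable [CharZero K]

theorem eq_of_forall_mem_spaceRing {c c' : Space K n} (h : ∀ f ∈ spaceRing K n, f c = f c') :
    c = c' :=
  eq_of_trS_eq fun a => h _ (trS_mem a)

/-- Every `K`-point of the ring of invariants comes from an orbit: some Gram determinant is nonzero
at the point, and the corresponding chart gives a pair of matrices. -/
theorem exists_eq_evalAt (χ : spaceRing K n →ₐ[K] K) : ∃ c, ∀ f, χ f = f.1 c := by
  rcases eq_or_ne n 0 with rfl | hn
  · exfalso
    have h0 : (1 : spaceRing K 0) = 0 := by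
      ext c
      obtain ⟨p, rfl⟩ := proj_surjective c
      exact absurd (p.2.symm.trans_le (rank_le_width _)) (by norm_num)
    simpa using congrArg χ h0
  let τ : Word → spaceRing K n := fun a => ⟨trS K n a, trS_mem a⟩
  have hτ : IsCMFunction n τ :=
    ⟨Subtype.ext isCMFunction_trS.one, fun a b => Subtype.ext (isCMFunction_trS.comm a b)⟩
  obtain ⟨a, b, hab⟩ := (hτ.map χ.toRingHom).exists_gram_det_ne_zero
  let d : spaceRing K n := ⟨chartDet K a b, chartDet_mem trS_mem _ _⟩
  let N : QuadIdx n → spaceRing K n :=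
    fun s => ⟨chartNum (trS K n) a b s, chartNum_mem trS_mem _ _ _⟩
  have hd : χ d ≠ 0 := by
    have h1 : (gram τ a b).det = d := Subtype.ext (map_gram_det (spaceRing K n).val.toRingHom τ a b)
    rw [← h1]
    rwa [← map_gram_det χ.toRingHom τ a b] at hab
  let y : QuadIdx n → K := fun s => χ (N s) * (χ d)⁻¹
  have hy : ∀ ij, MvPolynomial.aeval y (quadEqn K ij) = 0 := fun ij =>
    (aeval_chartNum_eq a b _ 0 (fun c hc => (exists_pair_chart a b hc).choose_spec.2.2 ij) χ _
      (mul_inv_cancel₀ hd)).trans (map_zero χ)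
  obtain ⟨p, hp⟩ := exists_pair_of_aeval_quadEqn hn hy
  refine ⟨proj K n p, fun f => ?_⟩
  obtain ⟨F, hF⟩ := mem_spaceRing.1 f.2
  have h1 := aeval_chartNum_eq a b (MvPolynomial.rename Sum.inl F) f (fun c hc => by
    obtain ⟨q, rfl, hq, -⟩ := exists_pair_chart a b hc
    rw [MvPolynomial.aeval_rename, hF, funext hq]
    rfl) χ _ (mul_inv_cancel₀ hd)
  rw [← h1, MvPolynomial.aeval_rename, hF, funext hp]
  rfl

/-- A finitely generated algebra of functions which separates points and whose `k`-points are all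
evaluations is the coordinate ring of an affine variety. -/
theorem isAffineVariety_of_fg {k X : Type*} [Field k] {A : Subalgebra k (X → k)} (hA : A.FG)
    (hsep : ∀ x y, (∀ f ∈ A, f x = f y) → x = y)
    (hev : ∀ χ : A →ₐ[k] k, ∃ x, ∀ f, χ f = f.1 x) : IsAffineVariety A := by
  obtain ⟨S, hS⟩ := hA
  let e := S.equivFin
  let g : Fin S.card → X → k := fun i => (e.symm i).1
  have hg : Set.range g = S := by
    ext f
    exact ⟨by rintro ⟨i, rfl⟩; exact (e.symm i).2, fun hf => ⟨e ⟨f, hf⟩, by simp [g]⟩⟩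
  have hmem : ∀ f : X → k, f ∈ A ↔
      ∃ p : MvPolynomial (Fin S.card) k, ∀ x, f x = MvPolynomial.eval (fun i => g i x) p := by
    intro f
    rw [← hS, ← hg, Algebra.adjoin_range_eq_range_aeval]
    have h : ∀ (p : MvPolynomial (Fin S.card) k) x,
        MvPolynomial.aeval g p x = MvPolynomial.eval (fun i => g i x) p := fun p x =>
      MvPolynomial.comp_aeval_apply g (Pi.evalAlgHom k (fun _ : X => k) x) p
    constructor
    · rintro ⟨p, rfl⟩
      exact ⟨p, h p⟩
    · rintro ⟨p, hp⟩
      exact ⟨p, funext fun x => (h p x).trans (hp x).symm⟩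
  refine ⟨S.card, fun x i => g i x, {p | ∀ x, MvPolynomial.eval (fun i => g i x) p = 0},
    ?_, ?_, hmem⟩
  · intro x y hxy
    refine hsep x y fun f hf => ?_
    obtain ⟨p, hp⟩ := (hmem f).1 hf
    rw [hp, hp]
    exact congrArg (fun v => MvPolynomial.eval v p) hxy
  · refine Set.Subset.antisymm ?_ fun v hv => ?_
    · rintro _ ⟨x, rfl⟩ p hp
      exact hp x
    · have hgA : ∀ i, g i ∈ A := fun i => (hmem _).2 ⟨MvPolynomial.X i, fun x => by simp⟩
      let gA : Fin S.card → A := fun i => ⟨g i, hgA i⟩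
      have hval : ∀ (p : MvPolynomial (Fin S.card) k) x,
          (MvPolynomial.aeval gA p).1 x = MvPolynomial.eval (fun i => g i x) p :=
        fun p x => MvPolynomial.comp_aeval_apply gA (evalAt A x) p
      have hsurj : Function.Surjective (MvPolynomial.aeval (R := k) gA) := by
        rintro ⟨f, hf⟩
        obtain ⟨p, hp⟩ := (hmem f).1 hf
        exact ⟨p, Subtype.ext (funext fun x => (hval p x).trans (hp x).symm)⟩
      have hker : ∀ p : MvPolynomial (Fin S.card) k, MvPolynomial.aeval gA p = 0 →
          MvPolynomial.aeval (R := k) v p = 0 := by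
        intro p hp
        rw [MvPolynomial.aeval_eq_eval]
        refine hv p fun x => ?_
        rw [← hval, hp]
        rfl
      let χ : A →ₐ[k] k := AlgHom.liftOfSurjective (MvPolynomial.aeval (R := k) gA) hsurj
        (MvPolynomial.aeval v) hker
      obtain ⟨x, hx⟩ := hev χ
      refine ⟨x, funext fun i => ?_⟩
      have h1 := hx (gA i)
      have h2 : χ (MvPolynomial.aeval gA (MvPolynomial.X i : MvPolynomial _ k)) = v i :=
        (AlgHom.liftOfSurjective_apply ..).trans (MvPolynomial.aeval_X _ _)
      rw [MvPolynomial.aeval_X] at h2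
      exact (h2.symm.trans h1).symm

theorem isAffineVariety_spaceRing : IsAffineVariety (spaceRing K n) :=
  isAffineVariety_of_fg spaceRing_fg (fun _ _ => eq_of_forall_mem_spaceRing) exists_eq_evalAt

/-! ### The geometric quotient -/

theorem isZariskiClosed_iff_preimage {Z : Set (Space K n)} :
    IsZariskiClosed (spaceRing K n) Z ↔ IsZariskiClosed (pairsRing K n) (proj K n ⁻¹' Z) := by
  constructor
  · rintro ⟨S, hS, rfl⟩
    refine ⟨(fun f => f ∘ proj K n) '' S, ?_, ?_⟩
    · rintro _ ⟨f, hf, rfl⟩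
      exact hS hf
    · ext p
      simp
  · rintro ⟨S, hS, hZ⟩
    refine ⟨{f | f ∈ spaceRing K n ∧ ∀ c ∈ Z, f c = 0}, fun f hf => hf.1, ?_⟩
    refine Set.Subset.antisymm (fun c hc f hf => hf.2 c hc) fun c hc => ?_
    obtain ⟨a, b, hd⟩ := exists_chartDet_ne_zero c
    obtain ⟨p, rfl, hp, -⟩ := exists_pair_chart a b hd
    change p ∈ proj K n ⁻¹' Z
    rw [hZ]
    intro f hf
    obtain ⟨m, h, H⟩ := exists_chart_fraction a b (hS hf)
    have h1 := hc (chartDet K a b * h.1) ⟨mul_mem (chartDet_mem trS_mem _ _) h.2, fun c' hc' => by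
      by_cases h0 : chartDet K a b c' = 0
      · simp [h0]
      · obtain ⟨q, rfl, hq, -⟩ := exists_pair_chart a b h0
        have h2 : q ∈ proj K n ⁻¹' Z := hc'
        rw [hZ] at h2
        simp [H q h0 hq, h2 f hf]⟩
    rw [Pi.mul_apply, H p hd hp] at h1
    exact (mul_eq_zero.1 ((mul_eq_zero.1 h1).resolve_left hd)).resolve_left (pow_ne_zero _ hd)

/-- An invariant function that is regular upstairs is regular downstairs: compose with the section
given by a chart. -/
theorem isRegularOn_of_comp_proj {U : Set (Space K n)} {f : Space K n → K} {F : Pairs K n → K}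
    (hF : IsRegularOn (pairsRing K n) (proj K n ⁻¹' U) F)
    (hf : ∀ p ∈ proj K n ⁻¹' U, F p = f (proj K n p)) : IsRegularOn (spaceRing K n) U f := by
  intro c hc
  obtain ⟨a, b, hd⟩ := exists_chartDet_ne_zero c
  obtain ⟨p, rfl, hp, -⟩ := exists_pair_chart a b hd
  obtain ⟨P, hP, Q, hQ, hQp, hPQ⟩ := hF p hc
  obtain ⟨m, h, H⟩ := exists_chart_fraction a b hP
  obtain ⟨m', h', H'⟩ := exists_chart_fraction a b hQ
  have hdm := chartDet_mem (K := K) trS_mem a b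
  refine ⟨chartDet K a b ^ (m' + 1) * h.1, mul_mem (pow_mem hdm _) h.2,
    chartDet K a b ^ (m + 1) * h'.1, mul_mem (pow_mem hdm _) h'.2, ?_, fun c' hc' hne => ?_⟩
  · simp only [Pi.mul_apply, Pi.pow_apply, H' p hd hp]
    exact mul_ne_zero (pow_ne_zero _ hd) (mul_ne_zero (pow_ne_zero _ hd) hQp)
  · simp only [Pi.mul_apply, Pi.pow_apply] at hne ⊢
    have h0 : chartDet K a b c' ≠ 0 := by
      intro h0
      rw [h0, pow_succ, mul_zero, zero_mul] at hne
      exact hne rfl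
    obtain ⟨q, rfl, hq, -⟩ := exists_pair_chart a b h0
    rw [H' q h0 hq] at hne ⊢
    rw [H q h0 hq, ← hf q hc']
    have hQq : Q q ≠ 0 := right_ne_zero_of_mul (right_ne_zero_of_mul hne)
    rw [hPQ q hc' hQq]
    field_simp
    ring

theorem isGeometricQuotient_proj :
    IsGeometricQuotient (GL (Fin n) K) (pairsRing K n) (spaceRing K n) (proj K n) where
  morphism _ hb := hb
  surjective := proj_surjective
  fibres _ _ := proj_eq_iff
  quotient_topology _ := isZariskiClosed_iff_preimage
  sheaf U _ F := by
    constructor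
    · rintro ⟨hF, hinv⟩
      have hf : ∀ p ∈ proj K n ⁻¹' U, F p = F (proj_surjective (proj K n p)).choose := by
        intro p hp
        obtain ⟨g, hg⟩ := proj_eq_iff.1 (proj_surjective (proj K n p)).choose_spec.symm
        rw [← hg, hinv g p hp]
      exact ⟨fun c => F (proj_surjective c).choose, isRegularOn_of_comp_proj hF hf, hf⟩
    · rintro ⟨f, hf, hfF⟩
      refine ⟨fun p hp => ?_, fun g p hp => ?_⟩
      · obtain ⟨P, hP, Q, hQ, hQp, hPQ⟩ := hf (proj K n p) hp
        exact ⟨P ∘ proj K n, hP, Q ∘ proj K n, hQ, hQp, fun q hq hne => by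
          rw [hfF q hq, hPQ _ hq hne]; rfl⟩
      · have h1 : proj K n (g • p) = proj K n p := (proj_eq_iff.2 ⟨g, rfl⟩).symm
        rw [hfF p hp, hfF (g • p) (by rw [Set.mem_preimage, h1]; exact hp), h1]
  coordinate_ring F := by
    constructor
    · rintro ⟨hF, hinv⟩
      have hf : F = (fun c => F (proj_surjective c).choose) ∘ proj K n := by
        ext p
        obtain ⟨g, hg⟩ := proj_eq_iff.1 (proj_surjective (proj K n p)).choose_spec.symm
        rw [Function.comp_apply, ← hg, hinv]
      refine ⟨_, ?_, hf⟩
      exact Eq.mp (congrArg (· ∈ pairsRing K n) hf) hF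
    · rintro ⟨f, hf, rfl⟩
      refine ⟨hf, fun g p => ?_⟩
      rw [Function.comp_apply, Function.comp_apply, ← proj_eq_iff.2 ⟨g, rfl⟩]

end Quotient

/-! ### Zero sets of real polynomials at points with surjective Jacobian -/

section Jacobian

open MvPolynomial

section Taylor

variable {σ : Type*} [Fintype σ]

theorem hasStrictFDerivAt_eval (f : MvPolynomial σ ℝ) (y : σ → ℝ) :
    HasStrictFDerivAt (fun y : σ → ℝ => eval y f)
      (∑ s, eval y (pderiv s f) • (ContinuousLinearMap.proj s : (σ → ℝ) →L[ℝ] ℝ)) y := by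
  classical
  induction f using MvPolynomial.induction_on with
  | C r => simpa using hasStrictFDerivAt_const r y
  | add p q hp hq =>
    have hfun : (fun y : σ → ℝ => eval y (p + q)) = (fun y => eval y p) + fun y => eval y q := by
      ext; simp
    rw [hfun]
    refine (hp.add hq).congr_fderiv ?_
    simp [add_smul, Finset.sum_add_distrib]
  | mul_X p s hp =>
    have hfun : (fun y : σ → ℝ => eval y (p * X s)) = (fun y => eval y p) * fun y => y s := by
      ext; simp
    rw [hfun]
    refine (hp.mul (hasStrictFDerivAt_apply (𝕜 := ℝ) s y)).congr_fderiv ?_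
    ext v
    simp [pderiv_X, Pi.single_apply, add_mul, Finset.sum_add_distrib, Finset.mul_sum, mul_assoc,
      apply_ite (eval y)]

/-- First order Taylor expansion with an increment of square zero. -/
theorem aeval_add_of_mul_eq_zero {R S : Type*} [CommRing R] [CommRing S] [Algebra R S]
    (y η : σ → S) (hη : ∀ s t, η s * η t = 0) (f : MvPolynomial σ R) :
    aeval (y + η) f = aeval y f + ∑ s, aeval y (pderiv s f) * η s := by
  classical
  induction f using MvPolynomial.induction_on with
  | C r => simp
  | add p q hp hq =>
    simp only [map_add, hp, hq, add_mul, Finset.sum_add_distrib]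
    ring
  | mul_X p s hp =>
    have h1 : (∑ t, aeval y (pderiv t p) * η t) * η s = 0 := by
      rw [Finset.sum_mul]
      exact Finset.sum_eq_zero fun t _ => by rw [mul_assoc, hη, mul_zero]
    have h2 : ∑ t, aeval y (pderiv t (p * X s)) * η t =
        (∑ t, aeval y (pderiv t p) * η t) * y s + aeval y p * η s := by
      simp [pderiv_X, Pi.single_apply, add_mul, Finset.sum_add_distrib, Finset.sum_mul,
        apply_ite (aeval y), add_comm]
      exact Finset.sum_congr rfl fun _ _ => by ring
    rw [h2, map_mul, map_mul, hp, aeval_X, aeval_X, Pi.add_apply]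
    linear_combination h1

end Taylor

section PointIdeal

variable {σ : Type*}

/-- The maximal ideal of a point. -/
def pointIdeal (q : σ → ℝ) : Ideal (MvPolynomial σ ℝ) :=
  Ideal.span (Set.range fun s => X s - C (q s))

theorem sub_C_eval_mem_pointIdeal (q : σ → ℝ) (f : MvPolynomial σ ℝ) :
    f - C (eval q f) ∈ pointIdeal q := by
  have h : (Ideal.Quotient.mkₐ ℝ (pointIdeal q)) =
      (Algebra.ofId ℝ (MvPolynomial σ ℝ ⧸ pointIdeal q)).comp (aeval q) := by
    refine algHom_ext fun s => ?_
    have : X s - C (q s) ∈ pointIdeal q := Ideal.subset_span ⟨s, rfl⟩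
    rw [← Ideal.Quotient.eq_zero_iff_mem, map_sub, sub_eq_zero] at this
    simp only [Ideal.Quotient.mkₐ_eq_mk, this, AlgHom.comp_apply, aeval_X]
    rfl
  have h1 := DFunLike.congr_fun h f
  rw [← Ideal.Quotient.eq_zero_iff_mem, map_sub, sub_eq_zero]
  rw [Ideal.Quotient.mkₐ_eq_mk] at h1
  rw [h1, AlgHom.comp_apply, aeval_eq_eval]
  rfl

theorem mem_pointIdeal {q : σ → ℝ} {f : MvPolynomial σ ℝ} :
    f ∈ pointIdeal q ↔ eval q f = 0 := by
  constructor
  · intro hf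
    have : pointIdeal q ≤ RingHom.ker (eval q) := by
      refine Ideal.span_le.2 ?_
      rintro _ ⟨s, rfl⟩
      simp [RingHom.mem_ker]
    exact this hf
  · intro hf
    have := sub_C_eval_mem_pointIdeal q f
    rwa [hf, C_0, sub_zero] at this

theorem derivation_mem_pow {k R : Type*} [CommRing k] [CommRing R] [Algebra k R]
    (D : Derivation k R R) (I : Ideal R) (r : ℕ) {f : R} (hf : f ∈ I ^ (r + 1)) :
    D f ∈ I ^ r := by
  induction r generalizing f with
  | zero => simp
  | succ r ih =>
    rw [pow_succ] at hf
    refine Submodule.mul_induction_on hf (fun a ha b hb => ?_) (fun a b ha hb => ?_)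
    · rw [D.leibniz, smul_eq_mul, smul_eq_mul]
      refine add_mem (Ideal.mul_mem_right _ _ ha) ?_
      rw [pow_succ']
      exact Ideal.mul_mem_mul hb (ih ha)
    · rw [map_add]
      exact add_mem ha hb

variable [Fintype σ]

/-- The Euler vector field centred at a point. -/
def euler (q : σ → ℝ) : Derivation ℝ (MvPolynomial σ ℝ) (MvPolynomial σ ℝ) :=
  ∑ s, (X s - C (q s)) • pderiv s

theorem euler_apply (q : σ → ℝ) (f : MvPolynomial σ ℝ) :
    euler q f = ∑ s, (X s - C (q s)) * pderiv s f := by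
  have := congrFun (map_sum Derivation.coeFnAddMonoidHom
    (fun s => (X s - C (q s)) • pderiv (R := ℝ) s) Finset.univ) f
  rw [Finset.sum_apply] at this
  exact this

theorem euler_mem (q : σ → ℝ) (f : MvPolynomial σ ℝ) : euler q f ∈ pointIdeal q := by
  rw [euler_apply]
  exact Ideal.sum_mem _ fun s _ => Ideal.mul_mem_right _ _ (Ideal.subset_span ⟨s, rfl⟩)

theorem euler_sub_mem (q : σ → ℝ) {f : MvPolynomial σ ℝ} (hf : f ∈ pointIdeal q) :
    euler q f - f ∈ pointIdeal q ^ 2 := by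
  classical
  refine Submodule.span_induction ?_ (by simp) (fun a b _ _ ha hb => ?_) (fun c a ha' ha => ?_) hf
  · rintro _ ⟨s, rfl⟩
    have : euler q (X s - C (q s)) = X s - C (q s) := by
      simp [euler_apply, pderiv_X, Pi.single_apply]
    rw [this, sub_self]
    exact zero_mem _
  · rw [map_add, add_sub_add_comm]
    exact add_mem ha hb
  · rw [smul_eq_mul, Derivation.leibniz, smul_eq_mul, smul_eq_mul, add_sub_right_comm, ← mul_sub]
    refine add_mem (Ideal.mul_mem_left _ _ ha) ?_
    rw [pow_two]
    exact Ideal.mul_mem_mul ha' (euler_mem q c)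

/-- Euler's identity for the leading form of a polynomial at a point. -/
theorem euler_sub_natCast_mul_mem (q : σ → ℝ) (r : ℕ) {f : MvPolynomial σ ℝ}
    (hf : f ∈ pointIdeal q ^ r) : euler q f - r * f ∈ pointIdeal q ^ (r + 1) := by
  induction r generalizing f with
  | zero => simpa using euler_mem q f
  | succ r ih =>
    rw [pow_succ] at hf
    refine Submodule.mul_induction_on hf (fun a ha b hb => ?_) (fun a b ha hb => ?_)
    · have h1 : euler q (a * b) - (r + 1 : ℕ) * (a * b) =
          a * (euler q b - b) + (euler q a - r * a) * b := by
        rw [Derivation.leibniz, smul_eq_mul, smul_eq_mul]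
        push_cast
        ring
      rw [h1]
      refine add_mem ?_ ?_
      · rw [show r + 1 + 1 = r + 2 from rfl, pow_add]
        exact Ideal.mul_mem_mul ha (euler_sub_mem q hb)
      · rw [pow_succ]
        exact Ideal.mul_mem_mul (ih ha) hb
    · rw [map_add, mul_add, add_sub_add_comm]
      exact add_mem ha hb

end PointIdeal

variable {σ ι : Type*} [Fintype σ]

/-- The Jacobian matrix of a family of polynomials. -/
def jacobian (F : ι → MvPolynomial σ ℝ) : Matrix ι σ (MvPolynomial σ ℝ) :=
  Matrix.of fun i s => pderiv s (F i)

/-- A real matrix as a matrix of constant polynomials. -/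
def constMatrix (M : Matrix σ ι ℝ) : Matrix σ ι (MvPolynomial σ ℝ) := Matrix.of fun s i => C (M s i)

/-- The product of the Jacobian with a constant matrix. -/
def jacMul (F : ι → MvPolynomial σ ℝ) (M : Matrix σ ι ℝ) : Matrix ι ι (MvPolynomial σ ℝ) :=
  jacobian F * constMatrix M

theorem eval_jacMul (F : ι → MvPolynomial σ ℝ) (M : Matrix σ ι ℝ) (y : σ → ℝ) :
    (jacMul F M).map (eval y) = (jacobian F).map (eval y) * M := by
  rw [jacMul, Matrix.map_mul]
  congr 1
  ext
  simp [constMatrix]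

/-- The ideal of polynomials that vanish at all real zeros of a family. -/
def realIdeal (F : ι → MvPolynomial σ ℝ) : Ideal (MvPolynomial σ ℝ) where
  carrier := {g | ∀ y, (∀ i, eval y (F i) = 0) → eval y g = 0}
  zero_mem' := fun y _ => map_zero _
  add_mem' := fun ha hb y hy => by rw [map_add, ha y hy, hb y hy, add_zero]
  smul_mem' := fun c g hg y hy => by rw [smul_eq_mul, map_mul, hg y hy, mul_zero]

variable [Fintype ι] [DecidableEq ι]

/-- At a zero of the family where the Jacobian is surjective, the differential of a
polynomial that vanishes on all real zeros vanishes on the kernel of the Jacobian. -/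
theorem sum_pderiv_mul_eq_zero {F : ι → MvPolynomial σ ℝ} {g : MvPolynomial σ ℝ}
    (hg : g ∈ realIdeal F) {y : σ → ℝ} (hy : ∀ i, eval y (F i) = 0)
    {M : Matrix σ ι ℝ} (hM : (jacobian F).map (eval y) * M = 1) {η : σ → ℝ}
    (hη : (jacobian F).map (eval y) *ᵥ η = 0) : ∑ s, eval y (pderiv s g) * η s = 0 := by
  let f : (σ → ℝ) → ι → ℝ := fun y i => eval y (F i)
  have hext : IsLocalExtrOn (fun y => eval y g) {x | f x = f y} y := by
    refine Or.inl ?_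
    filter_upwards [self_mem_nhdsWithin] with x hx
    have hx' : ∀ i, eval x (F i) = 0 := fun i => (congrFun hx i).trans (hy i)
    rw [hg x hx', hg y hy]
  obtain ⟨Λ, c, hne, h⟩ := hext.exists_linear_map_of_hasStrictFDerivAt
    (hasStrictFDerivAt_pi.2 fun i => hasStrictFDerivAt_eval (F i) y) (hasStrictFDerivAt_eval g y)
  have hf' : ∀ v : σ → ℝ, (ContinuousLinearMap.pi fun i => ∑ s, eval y (pderiv s (F i)) •
      (ContinuousLinearMap.proj s : (σ → ℝ) →L[ℝ] ℝ)) v = (jacobian F).map (eval y) *ᵥ v := by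
    intro v
    ext i
    simp [jacobian, mulVec, dotProduct]
  have hc : c ≠ 0 := by
    rintro rfl
    apply hne
    refine Prod.ext (LinearMap.ext fun v => ?_) rfl
    have := h (M *ᵥ v)
    rw [hf', mulVec_mulVec, hM, one_mulVec, zero_smul, add_zero] at this
    exact this
  have := h η
  rw [hf', hη, map_zero, zero_add, smul_eq_mul] at this
  simpa using (mul_eq_zero.1 this).resolve_left hc

section AtPoint

variable (F : ι → MvPolynomial σ ℝ) (M : Matrix σ ι ℝ)

theorem eval_det_jacMul (y : σ → ℝ) :
    eval y (jacMul F M).det = ((jacobian F).map (eval y) * M).det := by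
  rw [← eval_jacMul, RingHom.map_det]
  rfl

variable [DecidableEq σ]

/-- The columns of this matrix are polynomial vector fields that annihilate all `F i`. -/
def tangentMatrix : Matrix σ σ (MvPolynomial σ ℝ) :=
  (jacMul F M).det • 1 - constMatrix M * (jacMul F M).adjugate * jacobian F

theorem jacobian_mul_tangentMatrix : jacobian F * tangentMatrix F M = 0 := by
  rw [tangentMatrix, Matrix.mul_sub, Matrix.mul_smul, Matrix.mul_one, ← Matrix.mul_assoc,
    ← Matrix.mul_assoc]
  rw [show jacobian F * constMatrix M = jacMul F M from rfl, mul_adjugate, smul_mul,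
    Matrix.one_mul, sub_self]

variable {F M}

/-- The vanishing ideal of the real zeros is stable under the vector fields that annihilate
the equations, up to multiplication with a function that vanishes where the Jacobian may
degenerate. -/
theorem det_mul_sum_mem_realIdeal {g : MvPolynomial σ ℝ} (hg : g ∈ realIdeal F) (t : σ) :
    (jacMul F M).det * ∑ s, pderiv s g * tangentMatrix F M s t ∈ realIdeal F := by
  intro y hy
  rw [map_mul]
  by_cases h0 : eval y (jacMul F M).det = 0
  · rw [h0, zero_mul]
  rw [map_sum]
  simp only [map_mul]
  rw [sum_pderiv_mul_eq_zero hg hy (M := M * ((jacobian F).map (eval y) * M)⁻¹)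
    (η := fun s => eval y (tangentMatrix F M s t)), mul_zero]
  · rw [← Matrix.mul_assoc]
    refine mul_nonsing_inv _ (isUnit_iff_ne_zero.2 ?_)
    rwa [← eval_det_jacMul]
  · have h1 := congrArg (fun N : Matrix ι σ (MvPolynomial σ ℝ) => N.map (eval y))
      (jacobian_mul_tangentMatrix F M)
    simp only [Matrix.map_mul] at h1
    ext i
    have := congrFun (congrFun h1 i) t
    simpa [mul_apply, mulVec, dotProduct] using this

/-- If the Jacobian is surjective at `q`, then a polynomial that vanishes on the real zeros lies in
the ideal of the equations up to any order at `q`. Increasing the order by one uses Euler's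
identity: the Euler field is, up to terms in the ideal, a combination of vector fields
that preserve the ideal of the real zeros. -/
theorem realIdeal_le_sup_pow {q : σ → ℝ} (hq : ∀ i, eval q (F i) = 0)
    (hM : (jacobian F).map (eval q) * M = 1) (r : ℕ) :
    realIdeal F ≤ Ideal.span (Set.range F) ⊔ pointIdeal q ^ (r + 1) := by
  set m := pointIdeal q with hm
  set IF := Ideal.span (Set.range F) with hIF
  set δ := (jacMul F M).det with hδ
  have hFJ : IF ≤ realIdeal F := by
    refine Ideal.span_le.2 ?_
    rintro _ ⟨i, rfl⟩ y hy
    exact hy i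
  have hδ1 : δ - 1 ∈ m := by
    have : eval q δ = 1 := by rw [hδ, eval_det_jacMul, hM, det_one]
    rw [hm, mem_pointIdeal, map_sub, this, map_one, sub_self]
  -- The factor `δ` is invertible modulo any power of the maximal ideal.
  have hcancel : ∀ (j : ℕ) (f : MvPolynomial σ ℝ), f ∈ m ^ j → δ * f ∈ IF ⊔ m ^ (j + 1) →
      f ∈ IF ⊔ m ^ (j + 1) := by
    intro j f hf h
    have h1 : (δ - 1) * f ∈ m ^ (j + 1) := by
      rw [pow_succ']
      exact Ideal.mul_mem_mul hδ1 hf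
    have h2 := sub_mem h (Ideal.mem_sup_right (S := IF) h1)
    rwa [← sub_mul, sub_sub_cancel, one_mul] at h2
  have hmul : ∀ (i j : ℕ) {f g : MvPolynomial σ ℝ}, f ∈ IF ⊔ m ^ i → g ∈ m ^ j →
      f * g ∈ IF ⊔ m ^ (i + j) := by
    intro i j f g hf hg
    obtain ⟨a, ha, b, hb, rfl⟩ := Submodule.mem_sup.1 hf
    rw [add_mul, pow_add]
    exact Submodule.add_mem_sup (Ideal.mul_mem_right _ _ ha) (Ideal.mul_mem_mul hb hg)
  induction r with
  | zero =>
    intro g hg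
    refine Ideal.mem_sup_right ?_
    rw [zero_add, pow_one, hm, mem_pointIdeal]
    exact hg q hq
  | succ r ih =>
    intro g hg
    obtain ⟨φ, hφ, h, hh, rfl⟩ := Submodule.mem_sup.1 (ih hg)
    refine add_mem (Ideal.mem_sup_left hφ) ?_
    have hhJ : h ∈ realIdeal F := by
      simpa using sub_mem hg (hFJ hφ)
    have hD : ∀ s, pderiv s h ∈ m ^ r := fun s => derivation_mem_pow (pderiv s) m r hh
    have h1 : ∀ t, ∑ s, pderiv s h * tangentMatrix F M s t ∈ IF ⊔ m ^ (r + 1) := fun t =>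
      hcancel r _ (Ideal.sum_mem _ fun s _ => Ideal.mul_mem_right _ _ (hD s))
        (ih (det_mul_sum_mem_realIdeal hhJ t))
    have h2 : ∑ t, (∑ s, pderiv s h * tangentMatrix F M s t) * (X t - C (q t)) ∈
        IF ⊔ m ^ (r + 1 + 1) :=
      Ideal.sum_mem _ fun t _ => hmul _ 1 (h1 t) (by
        rw [pow_one]; exact Ideal.subset_span ⟨t, rfl⟩)
    have hEF : ∀ i, euler q (F i) ∈ IF ⊔ m ^ 2 := fun i => by
      have h3 := euler_sub_mem q (mem_pointIdeal.2 (hq i))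
      have h4 : F i ∈ IF := Ideal.subset_span ⟨i, rfl⟩
      simpa using add_mem (Ideal.mem_sup_left (T := m ^ 2) h4) (Ideal.mem_sup_right (S := IF) h3)
    have h5 : ∑ i, euler q (F i) * ∑ s, (constMatrix M * (jacMul F M).adjugate) s i * pderiv s h ∈
        IF ⊔ m ^ (r + 1 + 1) :=
      Ideal.sum_mem _ fun i _ => by
        have := hmul 2 r (hEF i)
          (g := ∑ s, (constMatrix M * (jacMul F M).adjugate) s i * pderiv s h)
          (Ideal.sum_mem _ fun s _ => Ideal.mul_mem_left _ _ (hD s))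
        rwa [add_comm 2 r] at this
    have h6 : δ * euler q h = ∑ t, (∑ s, pderiv s h * tangentMatrix F M s t) * (X t - C (q t)) +
        ∑ i, euler q (F i) * ∑ s, (constMatrix M * (jacMul F M).adjugate) s i * pderiv s h := by
      have e1 : ∀ s t, tangentMatrix F M s t = δ * (1 : Matrix σ σ (MvPolynomial σ ℝ)) s t -
          ∑ i, (constMatrix M * (jacMul F M).adjugate) s i * pderiv t (F i) := by
        intro s t
        rw [tangentMatrix, Matrix.sub_apply, Matrix.smul_apply, smul_eq_mul,
          mul_apply (M := constMatrix M * _)]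
        rfl
      have e2 : ∑ t, (∑ s, pderiv s h * (δ * (1 : Matrix σ σ (MvPolynomial σ ℝ)) s t)) *
          (X t - C (q t)) = δ * euler q h := by
        rw [euler_apply, Finset.mul_sum]
        refine Finset.sum_congr rfl fun t _ => ?_
        simp only [one_apply, mul_ite, mul_one, mul_zero, Finset.sum_ite_eq', Finset.mem_univ,
          if_true]
        ring
      have e3 : ∑ i, euler q (F i) * ∑ s, (constMatrix M * (jacMul F M).adjugate) s i * pderiv s h =
          ∑ t, (∑ s, pderiv s h *
            ∑ i, (constMatrix M * (jacMul F M).adjugate) s i * pderiv t (F i)) *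
              (X t - C (q t)) := by
        simp_rw [euler_apply, Finset.sum_mul_sum]
        rw [Finset.sum_comm]
        refine Finset.sum_congr rfl fun t _ => ?_
        rw [Finset.sum_comm, Finset.sum_mul]
        refine Finset.sum_congr rfl fun s _ => ?_
        rw [Finset.mul_sum, Finset.sum_mul]
        exact Finset.sum_congr rfl fun i _ => by ring
      rw [← e2, e3, ← Finset.sum_add_distrib]
      refine Finset.sum_congr rfl fun t _ => ?_
      rw [← add_mul, ← Finset.sum_add_distrib]
      congr 1
      refine Finset.sum_congr rfl fun s _ => ?_
      rw [e1]
      ring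
    have h7 : δ * euler q h ∈ IF ⊔ m ^ (r + 1 + 1) := h6 ▸ add_mem h2 h5
    have h8 : δ * ((r + 1 : ℕ) * h) ∈ IF ⊔ m ^ (r + 1 + 1) := by
      have h9 := Ideal.mul_mem_left _ δ (euler_sub_natCast_mul_mem q (r + 1) hh)
      have h10 := sub_mem h7 (Ideal.mem_sup_right (S := IF) h9)
      rwa [← mul_sub, sub_sub_cancel] at h10
    have h11 := Ideal.mul_mem_left _ (C ((r + 1 : ℕ) : ℝ)⁻¹)
      (hcancel (r + 1) _ (Ideal.mul_mem_left _ _ hh) h8)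
    rwa [← mul_assoc, ← map_natCast C, ← C_mul, inv_mul_cancel₀ (by positivity), C_1, one_mul]
      at h11

/-- If the Jacobian is surjective at the zero `q`, then near `q` the equations generate the
ideal of all polynomials that vanish on the real zeros. -/
theorem exists_mul_mem_span {q : σ → ℝ} (hq : ∀ i, eval q (F i) = 0)
    (hM : (jacobian F).map (eval q) * M = 1) {g : MvPolynomial σ ℝ} (hg : g ∈ realIdeal F) :
    ∃ u, eval q u ≠ 0 ∧ u * g ∈ Ideal.span (Set.range F) := by
  set IF := Ideal.span (Set.range F)
  have h1 : Ideal.Quotient.mk IF g ∈ (⨅ i : ℕ, (pointIdeal q).map (Ideal.Quotient.mk IF) ^ i •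
      (⊤ : Ideal (MvPolynomial σ ℝ ⧸ IF))) := by
    rw [Submodule.mem_iInf]
    intro r
    have h2 : g ∈ IF ⊔ pointIdeal q ^ r :=
      (realIdeal_le_sup_pow hq hM r).trans (sup_le_sup_left (Ideal.pow_le_pow_right r.le_succ) _) hg
    obtain ⟨a, ha, b, hb, rfl⟩ := Submodule.mem_sup.1 h2
    rw [map_add, Ideal.Quotient.eq_zero_iff_mem.2 ha, zero_add, smul_eq_mul, Ideal.mul_top,
      ← Ideal.map_pow]
    exact Ideal.mem_map_of_mem _ hb
  rw [Ideal.mem_iInf_smul_pow_eq_bot_iff] at h1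
  obtain ⟨⟨r, hr⟩, hrg⟩ := h1
  obtain ⟨r, hr', rfl⟩ := (Ideal.mem_map_iff_of_surjective _ Ideal.Quotient.mk_surjective).1 hr
  refine ⟨1 - r, ?_, ?_⟩
  · rw [map_sub, mem_pointIdeal.1 hr']
    simp
  · rw [← Ideal.Quotient.eq_zero_iff_mem, map_mul, map_sub, map_one, sub_mul, one_mul, sub_eq_zero]
    exact hrg.symm

/-- The coordinate ring of the real zeros is formally smooth at a zero with surjective
Jacobian, in the form of a lifting property. -/
theorem exists_lift_of_jacobian {q : σ → ℝ} (hq : ∀ i, eval q (F i) = 0)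
    (hM : (jacobian F).map (eval q) * M = 1) {B : Type*} [CommRing B] [Algebra ℝ B] {I : Ideal B}
    (hI : I ^ 2 = ⊥) (ψ : MvPolynomial σ ℝ →ₐ[ℝ] B ⧸ I) (hψ : ∀ i, ψ (F i) = 0)
    (hunit : ∀ u, eval q u ≠ 0 → IsUnit (ψ u)) :
    ∃ ψ' : MvPolynomial σ ℝ →ₐ[ℝ] B, (∀ f, Ideal.Quotient.mk I (ψ' f) = ψ f) ∧
      ∀ g ∈ realIdeal F, ψ' g = 0 := by
  have hnil : IsNilpotent I := ⟨2, hI⟩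
  have hzero : ∀ a ∈ I, ∀ b ∈ I, a * b = 0 := fun a ha b hb => by
    have : a * b ∈ I ^ 2 := by rw [pow_two]; exact Ideal.mul_mem_mul ha hb
    rwa [hI, Ideal.mem_bot] at this
  choose y hy using fun s => Ideal.Quotient.mk_surjective (ψ (X s))
  have hlift : ∀ (z : σ → B), (∀ s, Ideal.Quotient.mk I (z s) = ψ (X s)) → ∀ f,
      Ideal.Quotient.mk I (aeval z f) = ψ f := by
    intro z hz f
    have : (Ideal.Quotient.mkₐ ℝ I).comp (aeval z) = ψ := algHom_ext fun s => by simp [hz]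
    exact DFunLike.congr_fun this f
  let K : Matrix ι ι B := (aeval (R := ℝ) y).toRingHom.mapMatrix (jacMul F M)
  have hK : IsUnit K.det := by
    have h1 : K.det = aeval y (jacMul F M).det := (RingHom.map_det _ _).symm
    rw [h1, ← IsNilpotent.isUnit_quotient_mk_iff hnil, hlift y hy]
    refine hunit _ ?_
    rw [eval_det_jacMul, hM, det_one]
    exact one_ne_zero
  let e : ι → B := fun i => aeval y (F i)
  have he : ∀ i, e i ∈ I := fun i => by
    rw [← Ideal.Quotient.eq_zero_iff_mem, hlift y hy, hψ]
  -- One Newton step.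
  let η : σ → B := -((M.map (algebraMap ℝ B) * K⁻¹) *ᵥ e)
  have hη : ∀ s, η s ∈ I := fun s =>
    neg_mem (Ideal.sum_mem _ fun i _ => Ideal.mul_mem_left _ _ (he i))
  have hz : ∀ s, Ideal.Quotient.mk I ((y + η) s) = ψ (X s) := fun s => by
    rw [Pi.add_apply, map_add, Ideal.Quotient.eq_zero_iff_mem.2 (hη s), add_zero, hy]
  have hF : ∀ i, aeval (y + η) (F i) = 0 := by
    intro i
    rw [aeval_add_of_mul_eq_zero y η fun s t => hzero _ (hη s) _ (hη t)]
    have h1 : (jacobian F).map (aeval y) *ᵥ η = -e := by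
      have h2 : (jacobian F).map (aeval y) * M.map (algebraMap ℝ B) = K := by
        have h3 : (constMatrix M).map (aeval (R := ℝ) y) = M.map (algebraMap ℝ B) := by
          ext; simp [constMatrix]
        rw [← h3]
        exact (Matrix.map_mul (f := (aeval (R := ℝ) y).toRingHom)).symm
      rw [mulVec_neg, mulVec_mulVec, ← Matrix.mul_assoc, h2, mul_nonsing_inv _ hK, one_mulVec]
    have h4 := congrFun h1 i
    change ∑ s, aeval y (pderiv s (F i)) * η s = -(aeval y (F i)) at h4
    rw [h4, add_neg_cancel]
  refine ⟨aeval (y + η), hlift _ hz, fun g hg => ?_⟩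
  obtain ⟨u, hu, hug⟩ := exists_mul_mem_span hq hM hg
  have h1 : aeval (y + η) (u * g) = 0 := by
    have : Ideal.span (Set.range F) ≤ RingHom.ker (aeval (R := ℝ) (y + η)) := by
      refine Ideal.span_le.2 ?_
      rintro _ ⟨i, rfl⟩
      exact hF i
    exact this hug
  have h2 : IsUnit (aeval (y + η) u) := by
    rw [← IsNilpotent.isUnit_quotient_mk_iff hnil, hlift _ hz]
    exact hunit u hu
  rw [map_mul] at h1
  exact (h2.mul_right_eq_zero).1 h1

end AtPoint

end Jacobian

/-! ### Smoothness of the real orbit space -/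

section Smooth

open MvPolynomial

theorem exists_right_inverse_of_vecMul_eq_zero {K m l : Type*} [Field K] [Fintype m] [Fintype l]
    [DecidableEq m] (J : Matrix m l K) (h : ∀ y, y ᵥ* J = 0 → y = 0) :
    ∃ M : Matrix l m K, J * M = 1 := by
  classical
  have h1 : LinearIndependent K J.row := by
    rw [← Matrix.vecMul_injective_iff]
    exact (injective_iff_map_eq_zero J.vecMulLinear).2 h
  rw [← mulVec_surjective_iff_exists_right_inverse]
  have h2 : LinearMap.range J.mulVecLin = ⊤ := by
    refine Submodule.eq_top_of_finrank_eq ?_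
    rw [Module.finrank_fintype_fun_eq_card]
    exact h1.rank_matrix
  exact LinearMap.range_eq_top.1 h2

variable {n : ℕ}

theorem eval_pderiv_quadEqn_X (y : QuadIdx n → ℝ) (i j k l : Fin n) :
    eval y (pderiv (Sum.inl (Sum.inl (k, l))) (quadEqn ℝ (i, j))) =
      (if i = k then quadZ y l j else 0) - if j = l then quadZ y i k else 0 := by
  simp [quadEqn, moment, mul_apply, one_apply, pderiv_X, Pi.single_apply, quadZ,
    apply_ite (pderiv _), ite_and, apply_ite (eval y), Finset.sum_ite_irrel]

theorem eval_pderiv_quadEqn_Z (y : QuadIdx n → ℝ) (i j k l : Fin n) :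
    eval y (pderiv (Sum.inl (Sum.inr (k, l))) (quadEqn ℝ (i, j))) =
      (if j = l then quadX y i k else 0) - if i = k then quadX y l j else 0 := by
  simp [quadEqn, moment, mul_apply, one_apply, pderiv_X, Pi.single_apply, quadX,
    apply_ite (pderiv _), ite_and, apply_ite (eval y), Finset.sum_ite_irrel]

theorem eval_pderiv_quadEqn_W (y : QuadIdx n → ℝ) (i j k : Fin n) :
    eval y (pderiv (Sum.inr (Sum.inr k)) (quadEqn ℝ (i, j))) =
      -if j = k then quadV y i else 0 := by
  simp [quadEqn, moment, mul_apply, one_apply, pderiv_X, Pi.single_apply, quadV,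
    apply_ite (pderiv _), apply_ite (eval y)]

/-- The Jacobian of the equations `[X, Z] + 1 = v w` is surjective where the columns `a j v` form a
basis: a matrix that is orthogonal to its image commutes with `X` and `Z` and kills `v`. -/
theorem exists_right_inverse_jacobian {y : QuadIdx n → ℝ}
    (hy : ∀ ij, eval y (quadEqn ℝ ij) = 0) {a b : Fin n → Word}
    (hd : (gram (tr (quadX y) (quadZ y)) a b).det ≠ 0) :
    ∃ M : Matrix (QuadIdx n) (Fin n × Fin n) ℝ, (jacobian (quadEqn ℝ)).map (eval y) * M = 1 := by
  have h := moment_eq_of_aeval_quadEqn (R := ℝ) (y := y)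
    (fun ij => by rw [aeval_eq_eval]; exact hy ij)
  refine exists_right_inverse_of_vecMul_eq_zero _ fun t ht => ?_
  let Y : Matrix (Fin n) (Fin n) ℝ := Matrix.of fun i j => t (j, i)
  have ht' : ∀ s, ∑ j, ∑ i, Y j i * eval y (pderiv s (quadEqn ℝ (i, j))) = 0 := by
    intro s
    have := congrFun ht s
    rw [vecMul, dotProduct, Fintype.sum_prod_type_right] at this
    exact this
  have hX : Y * quadX y = quadX y * Y := by
    ext i j
    have := ht' (Sum.inl (Sum.inr (j, i)))
    simp only [eval_pderiv_quadEqn_Z, mul_sub, Finset.sum_sub_distrib, sub_eq_zero] at this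
    simpa [Finset.sum_ite_irrel, mul_apply, mul_comm] using this
  have hZ : Y * quadZ y = quadZ y * Y := by
    ext i j
    have := ht' (Sum.inl (Sum.inl (j, i)))
    simp only [eval_pderiv_quadEqn_X, mul_sub, Finset.sum_sub_distrib, sub_eq_zero] at this
    simpa [Finset.sum_ite_irrel, mul_apply, mul_comm] using this.symm
  have hv : Y *ᵥ quadV y = 0 := by
    ext i
    have := ht' (Sum.inr (Sum.inr i))
    simpa [eval_pderiv_quadEqn_W, Finset.sum_ite_irrel, mulVec, dotProduct] using this
  have hw := commute_word hX hZ
  set P : Matrix (Fin n) (Fin n) ℝ :=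
    Matrix.of fun i j => (word (quadX y) (quadZ y) (a j) *ᵥ quadV y) i with hP
  have hPu : IsUnit P.det := by
    refine isUnit_iff_ne_zero.2 fun h0 => hd ?_
    have := mul_word_mul_eq_gram h a b 1
    simp only [one_mul, map_one, Matrix.mul_one] at this
    rw [← this, det_mul, ← hP, h0, mul_zero]
  have hYP : Y * P = 0 := by
    ext i j
    have : (Y * P) i j = (Y *ᵥ (word (quadX y) (quadZ y) (a j) *ᵥ quadV y)) i := rfl
    rw [this, mulVec_mulVec, hw, ← mulVec_mulVec, hv, mulVec_zero]
    rfl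
  have hY : Y = 0 := by
    rw [← mul_nonsing_inv_cancel_right P Y hPu, hYP, zero_mul]
  ext ⟨i, j⟩
  exact congrFun (congrFun hY j) i

/-- To check formal smoothness of a local ring it is enough to lift maps from the local ring to maps
from the global ring, since units lift along nilpotent thickenings. -/
theorem formallySmooth_atPrime_of_lift.{u} {k A : Type u} [CommRing k] [CommRing A] [Algebra k A]
    (P : Ideal A) [P.IsPrime]
    (H : ∀ ⦃B : Type u⦄ [CommRing B] [Algebra k B] (I : Ideal B), I ^ 2 = ⊥ →
      ∀ f : Localization.AtPrime P →ₐ[k] B ⧸ I,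
        ∃ β : A →ₐ[k] B, ∀ g, Ideal.Quotient.mk I (β g) = f (algebraMap A _ g)) :
    Algebra.IsSmoothAt k P := by
  refine Algebra.FormallySmooth.of_comp_surjective fun B _ _ I hI f => ?_
  obtain ⟨β, hβ⟩ := H I hI f
  have hβunit : ∀ g : P.primeCompl, IsUnit (β g) := fun g => by
    rw [← IsNilpotent.isUnit_quotient_mk_iff ⟨2, hI⟩, hβ]
    exact (IsLocalization.map_units (Localization.AtPrime P) g).map f
  refine ⟨IsLocalization.liftAlgHom (S := Localization.AtPrime P) hβunit, ?_⟩
  refine AlgHom.coe_ringHom_injective (IsLocalization.ringHom_ext P.primeCompl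
    (RingHom.ext fun g => ?_))
  refine Eq.trans ?_ (hβ g)
  exact congrArg (Ideal.Quotient.mk I) (IsLocalization.lift_eq _ g)

/-- A chart is a map from a neighbourhood of `x` to the space of quadruples, hence gives a map from
polynomials in the coordinates of quadruples to the local ring at `x`. -/
theorem exists_chart_hom {x : Space ℝ n} {a b : Fin n → Word} (hd : chartDet ℝ a b x ≠ 0)
    {B : Type} [CommRing B] [Algebra ℝ B] (χ : spaceRing ℝ n →ₐ[ℝ] B)
    (hχ : ∀ f : spaceRing ℝ n, f.1 x ≠ 0 → IsUnit (χ f)) :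
    ∃ Φ : MvPolynomial (QuadIdx n) ℝ →ₐ[ℝ] B,
      (∀ (F : MvPolynomial (QuadIdx n) ℝ) (f : spaceRing ℝ n),
        (∀ c, chartDet ℝ a b c ≠ 0 → aeval (chart ℝ a b c) F = f.1 c) → Φ F = χ f) ∧
      ∀ F, eval (chart ℝ a b x) F ≠ 0 → IsUnit (Φ F) := by
  obtain ⟨u, hu⟩ := (hχ ⟨chartDet ℝ a b, chartDet_mem trS_mem a b⟩ hd).exists_right_inv
  refine ⟨aeval fun s => χ ⟨chartNum (trS ℝ n) a b s, chartNum_mem trS_mem a b s⟩ * u,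
    fun F f hf => aeval_chartNum_eq a b F f hf χ u hu, fun F hF => ?_⟩
  obtain ⟨m, h, H⟩ := exists_clear_denominators
    (fun s => (⟨chartNum (trS ℝ n) a b s, chartNum_mem trS_mem a b s⟩ : spaceRing ℝ n))
    ⟨chartDet ℝ a b, chartDet_mem trS_mem a b⟩ F
  have h1 : h.1 x = chartDet ℝ a b x ^ m * aeval (chart ℝ a b x) F :=
    H ℝ (evalAt (spaceRing ℝ n) x) _ (mul_inv_cancel₀ hd)
  have h2 : IsUnit (χ h) := by
    refine hχ h ?_
    rw [h1, aeval_eq_eval]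
    exact mul_ne_zero (pow_ne_zero _ hd) hF
  rw [H B χ u hu] at h2
  exact isUnit_of_mul_isUnit_right h2

/-- Invariant functions are polynomials in the entries of `X` and `Z`, well defined up to
polynomials that vanish on all real quadruples. So the pullback to quadruples is a homomorphism from
the ring of invariants to any algebra in which the latter polynomials become zero. -/
theorem exists_pullback_hom (hn : n ≠ 0) {B : Type*} [CommRing B] [Algebra ℝ B]
    (ψ : MvPolynomial (QuadIdx n) ℝ →ₐ[ℝ] B) (hψ : ∀ g ∈ realIdeal (quadEqn ℝ), ψ g = 0) :
    ∃ β : spaceRing ℝ n →ₐ[ℝ] B, ∀ (g : spaceRing ℝ n) (F : MvPolynomial (CoordIdx n) ℝ),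
      (∀ p, g.1 (proj ℝ n p) = aeval (coords p) F) → β g = ψ (rename Sum.inl F) := by
  choose rep hrep using fun f : spaceRing ℝ n => mem_spaceRing.1 f.2
  have hψrep : ∀ (g : spaceRing ℝ n) (F : MvPolynomial (CoordIdx n) ℝ),
      (∀ p, g.1 (proj ℝ n p) = aeval (coords p) F) →
        ψ (rename Sum.inl (rep g)) = ψ (rename Sum.inl F) := by
    intro g F hg
    rw [← sub_eq_zero, ← map_sub, ← map_sub]
    refine hψ _ fun y hy => ?_
    obtain ⟨p, hp⟩ := exists_pair_of_aeval_quadEqn (K := ℝ) hn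
      fun ij => by rw [aeval_eq_eval]; exact hy ij
    have h1 : y ∘ Sum.inl = coords p := funext fun s => (hp s).symm
    rw [eval_rename, h1, ← aeval_eq_eval, map_sub, ← hrep, ← hg, sub_self]
  refine ⟨
    { toFun := fun g => ψ (rename Sum.inl (rep g))
      map_one' := ?_
      map_zero' := ?_
      map_mul' := fun g g' => ?_
      map_add' := fun g g' => ?_
      commutes' := fun r => ?_ }, hψrep⟩
  · rw [hψrep 1 1 fun p => by rw [map_one]; rfl, map_one, map_one]
  · rw [hψrep (g * g') (rep g * rep g') fun p => by
      rw [map_mul, ← hrep, ← hrep]; rfl, map_mul, map_mul]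
  · exact (hψrep 0 0 fun p => by rw [map_zero]; rfl).trans (by rw [map_zero, map_zero])
  · refine (hψrep (g + g') (rep g + rep g') fun p => ?_).trans (by rw [map_add, map_add])
    rw [map_add, ← hrep, ← hrep]
    rfl
  · refine (hψrep (algebraMap ℝ _ r) (C r) fun p => ?_).trans ?_
    · rw [aeval_C]; rfl
    · rw [rename_C]
      exact ψ.commutes r

/-- Locally the composition `orbit space → quadruples → orbit space` of a chart and the quotient map
is the identity, so smoothness of the space of quadruples is inherited: a map from the local ring at
`x` to `B ⧸ I` is extended to quadruples by the chart, lifted to `B` there, and pulled back. -/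
theorem isSmoothVariety_spaceRing : IsSmoothVariety (spaceRing ℝ n) := by
  intro x
  have hn : n ≠ 0 := by
    rintro rfl
    obtain ⟨p, -⟩ := proj_surjective x
    exact absurd (p.2.symm.trans_le (rank_le_width _)) (by norm_num)
  obtain ⟨a, b, hd⟩ := exists_chartDet_ne_zero x
  obtain ⟨p, hpx, hp, hq⟩ := exists_pair_chart a b hd
  have hq' : ∀ ij, eval (chart ℝ a b x) (quadEqn ℝ ij) = 0 := fun ij => by
    rw [← aeval_eq_eval]; exact hq ij
  obtain ⟨M, hM⟩ := exists_right_inverse_jacobian (a := a) (b := b) hq' (by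
    have hX : quadX (chart ℝ a b x) = p.1.1 := by ext i j; exact (hp (Sum.inl (i, j))).symm
    have hZ : quadZ (chart ℝ a b x) = p.1.2 := by ext i j; exact (hp (Sum.inr (i, j))).symm
    rw [hX, hZ]
    rwa [← hpx, chartDet_apply] at hd)
  have hunit : ∀ f : spaceRing ℝ n, f.1 x ≠ 0 → IsUnit (IsScalarTower.toAlgHom ℝ (spaceRing ℝ n)
      (Localization.AtPrime (idealAt (spaceRing ℝ n) x)) f) := fun f hf =>
    IsLocalization.map_units (Localization.AtPrime (idealAt (spaceRing ℝ n) x))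
      (⟨f, hf⟩ : (idealAt (spaceRing ℝ n) x).primeCompl)
  obtain ⟨Φ, hΦ, hΦunit⟩ := exists_chart_hom hd
    (B := Localization.AtPrime (idealAt (spaceRing ℝ n) x))
    (IsScalarTower.toAlgHom ℝ (spaceRing ℝ n)
      (Localization.AtPrime (idealAt (spaceRing ℝ n) x))) hunit
  refine formallySmooth_atPrime_of_lift _ fun B _ _ I hI f => ?_
  obtain ⟨ψ, hψ, hψ0⟩ := exists_lift_of_jacobian hq' hM hI (f.comp Φ)
    (fun ij => by
      rw [AlgHom.comp_apply, hΦ _ 0 fun c hc => (exists_pair_chart a b hc).choose_spec.2.2 ij,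
        map_zero, map_zero])
    (fun F hF => (hΦunit F hF).map f)
  obtain ⟨β, hβ⟩ := exists_pullback_hom hn ψ hψ0
  refine ⟨β, fun g => ?_⟩
  obtain ⟨F, hF⟩ := mem_spaceRing.1 g.2
  have h1 := hΦ (rename Sum.inl F) g fun c hc => by
    obtain ⟨p, rfl, hp, -⟩ := exists_pair_chart a b hc
    rw [aeval_rename, hF, funext hp]
    rfl
  rw [hβ g F hF, hψ, AlgHom.comp_apply, h1]
  rfl

end Smooth

/-! ### The real locus -/

section RealLocus

open MvPolynomial

variable {n : ℕ}

theorem coords_complexify (p : Pairs ℝ n) (s : CoordIdx n) :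
    coords (complexify p) s = ((coords p s : ℝ) : ℂ) := by
  rcases s with ⟨i, j⟩ | ⟨i, j⟩ <;> rfl

theorem aeval_coords_complexify (p : Pairs ℝ n) (F : MvPolynomial (CoordIdx n) ℝ) :
    aeval (coords (complexify p)) F = ((aeval (coords p) F : ℝ) : ℂ) := by
  have h : coords (complexify p) = algebraMap ℝ ℂ ∘ coords p := funext (coords_complexify p)
  rw [h]
  exact aeval_algebraMap_apply ℂ (coords p) F

theorem trS_complexify (a : Word) (p : Pairs ℝ n) :
    trS ℂ n a (proj ℂ n (complexify p)) = (trS ℝ n a (proj ℝ n p) : ℂ) := by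
  rw [trS_proj, trS_proj, ← aeval_genericTr (R := ℝ), ← aeval_genericTr (R := ℝ),
    aeval_coords_complexify]

/-- The map `R_n → C_n` induced by the inclusion of the real pairs in the complex pairs. -/
def realToComplex (n : ℕ) : Space ℝ n → Space ℂ n :=
  Quotient.lift (fun p => proj ℂ n (complexify p)) (by
    rintro _ q ⟨g, rfl⟩
    refine eq_of_trS_eq fun a => ?_
    rw [trS_complexify, trS_complexify, ← proj_eq_iff.2 ⟨g, rfl⟩])

theorem realToComplex_proj (p : Pairs ℝ n) :
    realToComplex n (proj ℝ n p) = proj ℂ n (complexify p) := rfl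

theorem trS_realToComplex (a : Word) (c : Space ℝ n) :
    trS ℂ n a (realToComplex n c) = (trS ℝ n a c : ℂ) := by
  obtain ⟨p, rfl⟩ := proj_surjective c
  exact trS_complexify a p

theorem range_realToComplex : Set.range (realToComplex n) = realLocus n := by
  rw [realLocus, ← Set.range_comp]
  exact (proj_surjective.range_comp (realToComplex n)).symm

theorem realToComplex_injective : Function.Injective (realToComplex n) := fun c c' h =>
  eq_of_trS_eq fun a => by
    have := congrArg (trS ℂ n a) h
    rw [trS_realToComplex, trS_realToComplex] at this
    exact_mod_cast this

theorem trS_mem_realInvariants (a : Word) : trS ℂ n a ∈ realInvariants n :=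
  ⟨trS_mem a, genericTr ℝ n a, fun p => by rw [aeval_genericTr, trS_proj]⟩

/-- A point at which all real invariants are real lies in the real locus: the chart gives a
representative whose entries are rational functions of the trace functions, hence real. -/
theorem realLocus_eq :
    realLocus n = {c | ∀ f ∈ realInvariants n, ∃ r : ℝ, f c = (r : ℂ)} := by
  refine Set.Subset.antisymm ?_ fun c hc => ?_
  · rintro _ ⟨_, ⟨p, rfl⟩, rfl⟩ f ⟨-, F, hF⟩
    exact ⟨_, (hF _).trans (aeval_coords_complexify p F)⟩
  · choose τ hτ using fun a => hc _ (trS_mem_realInvariants a)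
    obtain ⟨a, b, hd⟩ := exists_chartDet_ne_zero c
    obtain ⟨p, rfl, hp, -⟩ := exists_pair_chart a b hd
    have h1 : (fun w => trS ℂ n w (proj ℂ n p)) = fun w => Complex.ofRealHom (τ w) := funext hτ
    have h2 : ∀ s, coords p s =
        ((chartNum τ a b (Sum.inl s) * (gram τ a b).det⁻¹ : ℝ) : ℂ) := by
      intro s
      rw [hp, chart, chartNum_apply, chartDet_apply, h1, ← map_chartNum, ← map_gram_det]
      simp
    let X : Matrix (Fin n) (Fin n) ℝ := Matrix.of fun i j =>
      chartNum τ a b (Sum.inl (Sum.inl (i, j))) * (gram τ a b).det⁻¹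
    let Z : Matrix (Fin n) (Fin n) ℝ := Matrix.of fun i j =>
      chartNum τ a b (Sum.inl (Sum.inr (i, j))) * (gram τ a b).det⁻¹
    have hX : Complex.ofRealHom.mapMatrix X = p.1.1 := by
      ext i j; exact (h2 (Sum.inl (i, j))).symm
    have hZ : Complex.ofRealHom.mapMatrix Z = p.1.2 := by
      ext i j; exact (h2 (Sum.inr (i, j))).symm
    have hr : (X * Z - Z * X + 1).rank = 1 := by
      rw [← rank_map_ofReal]
      change (Complex.ofRealHom.mapMatrix (X * Z - Z * X + 1)).rank = 1
      rw [map_add, map_sub, map_mul, map_mul, map_one, hX, hZ]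
      exact p.2
    refine ⟨p, ⟨⟨(X, Z), hr⟩, Subtype.ext (Prod.ext hX hZ)⟩, rfl⟩

theorem isZariskiClosed_realLocus :
    IsZariskiClosed (realStructure (spaceRing ℂ n)) (realLocus n) := by
  refine ⟨{g | ∃ f ∈ realInvariants n, g = fun c => (f c).im}, ?_, ?_⟩
  · rintro _ ⟨f, hf, rfl⟩
    exact Algebra.subset_adjoin (Or.inr ⟨f, hf.1, rfl⟩)
  · rw [realLocus_eq]
    ext c
    constructor
    · rintro h _ ⟨f, hf, rfl⟩
      obtain ⟨r, hr⟩ := h f hf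
      simp [hr]
    · intro h f hf
      exact ⟨(f c).re, Complex.ext rfl (h _ ⟨f, hf, rfl⟩)⟩

/-- The real and imaginary part of a complex polynomial at real points are real polynomials. -/
theorem exists_re_im_eq_aeval {σ : Type*} (F : MvPolynomial σ ℂ) :
    ∃ P Q : MvPolynomial σ ℝ, ∀ y : σ → ℝ,
      aeval (fun s => (y s : ℂ)) F = ((aeval y P : ℝ) : ℂ) + ((aeval y Q : ℝ) : ℂ) * Complex.I := by
  induction F using MvPolynomial.induction_on with
  | C r => exact ⟨C r.re, C r.im, fun y => by simp⟩
  | add p q hp hq =>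
    obtain ⟨P, Q, h⟩ := hp
    obtain ⟨P', Q', h'⟩ := hq
    refine ⟨P + P', Q + Q', fun y => ?_⟩
    rw [map_add, h, h', map_add, map_add]
    push_cast
    ring
  | mul_X p s hp =>
    obtain ⟨P, Q, h⟩ := hp
    refine ⟨P * X s, Q * X s, fun y => ?_⟩
    rw [map_mul, h, map_mul, map_mul, aeval_X, aeval_X]
    push_cast
    ring

theorem isMorphism_realToComplex :
    IsMorphism (spaceRing ℝ n) (realStructure (spaceRing ℂ n)) (realToComplex n) := by
  have h : realStructure (spaceRing ℂ n) ≤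
      (spaceRing ℝ n).comap (pullback ℝ (realToComplex n)) := by
    refine Algebra.adjoin_le ?_
    have key : ∀ f ∈ spaceRing ℂ n, ∃ P Q : MvPolynomial (CoordIdx n) ℝ, ∀ p,
        f (realToComplex n (proj ℝ n p)) =
          ((aeval (coords p) P : ℝ) : ℂ) + ((aeval (coords p) Q : ℝ) : ℂ) * Complex.I := by
      intro f hf
      obtain ⟨F, hF⟩ := mem_spaceRing.1 hf
      obtain ⟨P, Q, h⟩ := exists_re_im_eq_aeval F
      refine ⟨P, Q, fun p => ?_⟩
      rw [← h, realToComplex_proj, hF, funext (coords_complexify p)]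
    rintro _ (⟨f, hf, rfl⟩ | ⟨f, hf, rfl⟩)
    · obtain ⟨P, Q, h⟩ := key f hf
      refine mem_spaceRing.2 ⟨P, fun p => ?_⟩
      change (f (realToComplex n (proj ℝ n p))).re = _
      simp [h]
    · obtain ⟨P, Q, h⟩ := key f hf
      refine mem_spaceRing.2 ⟨Q, fun p => ?_⟩
      change (f (realToComplex n (proj ℝ n p))).im = _
      simp [h]
  exact fun b hb => h hb

/-- The real invariants are generated by the trace functions, which are restrictions of the real
parts of the complex ones. -/
theorem exists_comp_realToComplex_eq {f : Space ℝ n → ℝ} (hf : f ∈ spaceRing ℝ n) :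
    ∃ g ∈ realStructure (spaceRing ℂ n), g ∘ realToComplex n = f := by
  rw [spaceRing_eq_adjoin] at hf
  have h : Algebra.adjoin ℝ (Set.range (trS ℝ n)) ≤
      (realStructure (spaceRing ℂ n)).map (pullback ℝ (realToComplex n)) := by
    refine Algebra.adjoin_le ?_
    rintro _ ⟨a, rfl⟩
    refine ⟨fun c => (trS ℂ n a c).re, Algebra.subset_adjoin (Or.inl ⟨_, trS_mem a, rfl⟩), ?_⟩
    ext c
    change (trS ℂ n a (realToComplex n c)).re = _
    rw [trS_realToComplex, Complex.ofReal_re]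
  exact h hf

theorem realToComplex_mem (r : Space ℝ n) : realToComplex n r ∈ realLocus n :=
  range_realToComplex ▸ Set.mem_range_self r

theorem isIsomorphism_realToComplex :
    IsIsomorphism (spaceRing ℝ n)
      (restrict (realStructure (spaceRing ℂ n)) (realLocus n))
      (fun r => (⟨realToComplex n r, realToComplex_mem r⟩ : realLocus n)) := by
  have hsurj : Function.Surjective
      (fun r => (⟨realToComplex n r, realToComplex_mem r⟩ : realLocus n)) := by
    rintro ⟨c, hc⟩
    obtain ⟨r, rfl⟩ := range_realToComplex.symm ▸ hc
    exact ⟨r, rfl⟩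
  refine ⟨⟨fun r r' h => realToComplex_injective (congrArg Subtype.val h), hsurj⟩, fun b => ?_⟩
  constructor
  · rintro ⟨g, hg, rfl⟩
    exact isMorphism_realToComplex g hg
  · intro hb
    obtain ⟨g, hg, hgb⟩ := exists_comp_realToComplex_eq hb
    refine ⟨g, hg, funext fun c => ?_⟩
    obtain ⟨r, rfl⟩ := hsurj c
    exact congrFun hgb r

end RealLocus

end RealCM

end

theorem mainTheorem10 (n : ℕ) :
    RealCM.realLocus n =
        {c : RealCM.Space ℂ n | ∀ f ∈ RealCM.realInvariants n, ∃ r : ℝ, f c = (r : ℂ)} ∧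
      RealCM.IsZariskiClosed (RealCM.realStructure (RealCM.spaceRing ℂ n))
        (RealCM.realLocus n) ∧
      RealCM.IsAffineVariety (RealCM.spaceRing ℝ n) ∧
      RealCM.IsGeometricQuotient (Matrix.GeneralLinearGroup (Fin n) ℝ)
        (RealCM.pairsRing ℝ n) (RealCM.spaceRing ℝ n) (RealCM.proj ℝ n) ∧
      RealCM.IsSmoothVariety (RealCM.spaceRing ℝ n) ∧
      ∃ i : RealCM.Space ℝ n → RealCM.Space ℂ n,
        (∀ p : RealCM.Pairs ℝ n,
          i (RealCM.proj ℝ n p) = RealCM.proj ℂ n (RealCM.complexify p)) ∧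
        RealCM.IsMorphism (RealCM.spaceRing ℝ n)
          (RealCM.realStructure (RealCM.spaceRing ℂ n)) i ∧
        ∃ hi : ∀ r, i r ∈ RealCM.realLocus n,
          RealCM.IsIsomorphism (RealCM.spaceRing ℝ n)
            (RealCM.restrict (RealCM.realStructure (RealCM.spaceRing ℂ n)) (RealCM.realLocus n))
            (fun r => (⟨i r, hi r⟩ : RealCM.realLocus n)) :=
  ⟨RealCM.realLocus_eq, RealCM.isZariskiClosed_realLocus, RealCM.isAffineVariety_spaceRing,
    RealCM.isGeometricQuotient_proj, RealCM.isSmoothVariety_spaceRing, RealCM.realToComplex n,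
    RealCM.realToComplex_proj, RealCM.isMorphism_realToComplex, RealCM.realToComplex_mem,
    RealCM.isIsomorphism_realToComplex⟩
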